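/- Let $L$ be a real vector space with a bilinear form $[\cdot,\cdot]:L\times L\to\mathbb{R}$ such that $\omega(\xi,\xi')=\frac12[\xi,\xi']-\frac12[\xi',\xi]$ is non-degenerate and $L=M+N$, where $M=\{\tau:[\xi,\tau]=0\ \forall\xi\}$ and $N=\{\tau:[\tau,\xi]=0\ \forall\xi\}$. Let $J:L\to L$ be linear with $J^2=-1$ and $\omega(J\cdot,J\cdot)=\omega$, such that $g(\tau,\xi)=2\omega(\tau,J\xi)$ is positive definite and makes $L$ a separable real Hilbert space (of finite or infinite dimension) on which $[\cdot,\cdot]$ is continuous. Put $\{\tau,\xi\}=g(\tau,\xi)+2\mathrm{i}\,\omega(\tau,\xi)$. Let $q:L\to Q=L/M$ be the quotient map, with the quotient norm on $Q$, let $j:Q\to JM\subseteq L$ be the linear section of $q$ with image in $JM$, regard $[\cdot,\cdot]$ also as a map $L\times Q\to\mathbb{R}$, and let $\Omega(\phi,\phi')=g(j\phi,j\phi')-\mathrm{i}[j\phi,\phi']$ on $Q$. For a real Hilbert space $E$ let $\hat E$ be the algebraic dual of the topological dual of $E$, with the $\sigma$-algebra generated by the elements of the topological dual of $E$; continuous linear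 maps $E\to\mathbb{C}$ extend canonically to $\hat E$. Let $\nu_Q$ and $\nu_L$ be the centred Gaussian measures on $\hat Q$ and $\hat L$ under which each continuous linear functional $f$ has variance $\frac12\|f\|^2$, respectively $\|f\|^2$ (formally $\mathrm{d}\nu_Q=e^{-\Re\Omega(\phi,\phi)}\mathrm{d}\phi$ and $\mathrm{d}\nu_L=e^{-\frac12 g(\xi,\xi)}\mathrm{d}\xi$). Let $\mathcal{H}^{\tilde S}=L^2(\hat Q,\nu_Q)$ be the space of reduced Schrödinger wave functions, with the normalized coherent states $$k_\tau(\phi)=\exp\left(\Omega(q\tau,\phi)+\mathrm{i}[\tau,\phi]-\tfrac12\Omega(q\tau,q\tau)-\tfrac{\mathrm{i}}2[\tau,\tau]\right),\qquad \tau\in L.$$ Let $\mathcal{H}^H=H^2(\hat L,\nu_L)$ be the closure in $L^2(\hat L,\nu_L)$ of the square-integrable holomorphic functions of finitely many continuous complex-linear functionals on $(L,J)$. It contains the coherent states $K_\tau(\xi)=\exp(\frac12\{\tau,\xi\})$, and a state $\psi\in\mathcal{H}^H$ has the wave function $\psi(\tau)=\langle K_\tau,\psi\rangle$ on $L$. For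 a continuous linear observable $F:L\to\mathbb{R}$ let $X_F\in L$ be given by $2\omega(\xi,X_F)=F(\xi)$ for all $\xi\in L$, let $F^{\pm}(\xi)=\frac12(F(\xi)\mp\mathrm{i}F(J\xi))$, and let $X_{F^-}=\frac12(X_F-\mathrm{i}JX_F)$. The quantizations of $F$ are $$(\check F\psi)(\phi)=\left(-[X_F,\phi]+\mathrm{i}\,\Omega(qX_F,\phi)\right)\psi(\phi)-\mathrm{i}(D_{qX_F}\psi)(\phi)\quad(\phi\in\hat Q),$$ $$(\check F\psi)(\xi)=F^+(\xi)\psi(\xi)-\mathrm{i}(D_{X_{F^-}}\psi)(\xi)\quad(\xi\in L),$$ with $D$ the directional derivative. Let $\mathcal{H}^{\tilde S,cp}$ (respectively $\mathcal{H}^{H,cp}$) be the complex linear span of all $\check F_1\cdots\check F_nk_\tau$ (respectively $\check F_1\cdots\check F_nK_\tau$) with $n\ge0$, $\tau\in L$ and $F_i:L\to\mathbb{R}$ continuous linear. Then there is a unique isometric isomorphism $\mathcal{B}:\mathcal{H}^{\tilde S}\to\mathcal{H}^H$ with $\mathcal{B}k_\tau=e^{-\frac14 g(\tau,\tau)}K_\tau$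 for all $\tau\in L$. All functions in $\mathcal{H}^{\tilde S,cp}$ and $\mathcal{H}^{H,cp}$ represent elements of $\mathcal{H}^{\tilde S}$ and $\mathcal{H}^H$, and each $\check F$ is a well-defined linear operator on each of these two spaces. Moreover $\mathcal{B}$ restricts to a linear isomorphism $\mathcal{H}^{\tilde S,cp}\to\mathcal{H}^{H,cp}$, and $\mathcal{B}\check F\tilde\psi=\check F\mathcal{B}\tilde\psi$ for every continuous linear $F:L\to\mathbb{R}$ and every $\tilde\psi\in\mathcal{H}^{\tilde S,cp}$. -/

import Mathlib

open MeasureTheory ProbabilityTheory Topology Filter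
open scoped NNReal ENNReal InnerProductSpace

universe u

namespace OecklQuantization
noncomputable section

/-- The algebraic dual of the topological dual of `E`. -/
abbrev Hat (E : Type*) [SeminormedAddCommGroup E] [NormedSpace ℝ E] : Type _ :=
  Module.Dual ℝ (StrongDual ℝ E)

section hat
variable {E : Type*} [SeminormedAddCommGroup E] [NormedSpace ℝ E]

/-- The cylinder `σ`-algebra, i.e. the projective limit of the Borel `σ`-algebras of the
finite-dimensional quotients of `E`. -/
instance instMeasurableSpaceHat : MeasurableSpace (Hat E) :=
  ⨆ f : StrongDual ℝ E, MeasurableSpace.comap (fun x : Hat E => x f) inferInstance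

theorem measurable_eval (f : StrongDual ℝ E) : Measurable (fun x : Hat E => x f) :=
  Measurable.of_comap_le (le_iSup (fun f : StrongDual ℝ E =>
    MeasurableSpace.comap (fun x : Hat E => x f) inferInstance) f)

theorem measurable_toHat {Ω : Type*} [MeasurableSpace Ω] {S : Ω → Hat E}
    (h : ∀ f, Measurable (fun ω => S ω f)) : Measurable S := by
  rw [measurable_iff_comap_le]
  simp only [instMeasurableSpaceHat, MeasurableSpace.comap_iSup, MeasurableSpace.comap_comp]
  exact iSup_le fun f => (h f).comap_le

/-- `ν` is the centred Gaussian measure on `Hat E` whose image under every `f` in the topological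
dual of `E` is normal with variance `v ‖f‖²`.  (These images determine `ν`, as the functionals `f`
generate the `σ`-algebra and form a vector space.)  If `E` is a finite-dimensional Hilbert space, so
that `Hat E = E`, then `ν` has density proportional to `exp (- ‖x‖² / (2 v))`. -/
def IsHatGaussian (ν : Measure (Hat E)) (v : ℝ≥0) : Prop :=
  ∀ f : StrongDual ℝ E, ν.map (fun x : Hat E => x f) = gaussianReal 0 (v * ‖f‖₊ ^ 2)

/-- The canonical inclusion `E → Hat E`. -/
def incl (x : E) : Hat E := ContinuousLinearMap.coeLM ℝ |>.flip x

theorem incl_apply (x : E) (f : StrongDual ℝ E) : incl x f = f x := rfl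

/-- The canonical extension to `Hat E` of a continuous real-linear map `E → ℂ`. -/
def ext (l : E →L[ℝ] ℂ) (x : Hat E) : ℂ :=
  (x (Complex.reCLM.comp l) : ℂ) + (x (Complex.imCLM.comp l) : ℂ) * Complex.I

theorem ext_incl (l : E →L[ℝ] ℂ) (x : E) : ext l (incl x) = l x :=
  Complex.re_add_im (l x)

theorem IsHatGaussian.memLp_exp {ν : Measure (Hat E)} {v : ℝ≥0} (hν : IsHatGaussian ν v)
    (l : E →L[ℝ] ℂ) (c : ℂ) : MemLp (fun x : Hat E => Complex.exp (ext l x + c)) 2 ν := by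
  have hm : Measurable fun x : Hat E => Complex.exp (ext l x + c) := by
    have h1 := measurable_eval (E := E) (Complex.reCLM.comp l)
    have h2 := measurable_eval (E := E) (Complex.imCLM.comp l)
    exact Complex.measurable_exp.comp (((Complex.measurable_ofReal.comp h1).add
      ((Complex.measurable_ofReal.comp h2).mul_const _)).add_const _)
  rw [memLp_two_iff_integrable_sq_norm hm.aestronglyMeasurable]
  have h3 : (fun x : Hat E => ‖Complex.exp (ext l x + c)‖ ^ 2)
      = fun x => Real.exp (2 * c.re) * ((fun y : ℝ => Real.exp (2 * y)) ∘
          fun x : Hat E => x (Complex.reCLM.comp l)) x := by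
    funext x
    rw [Complex.norm_exp, ← Real.exp_nat_mul, Function.comp, ← Real.exp_add]
    congr 1
    simp [ext]
    ring
  rw [h3]
  refine Integrable.const_mul ?_ _
  rw [← integrable_map_measure (by fun_prop) (measurable_eval _).aemeasurable, hν]
  exact integrable_exp_mul_gaussianReal 2

end hat

/-- A Gaussian Hilbert space indexed by the Hilbert space `H`. -/
theorem exists_isonormal (H : Type u) [NormedAddCommGroup H] [InnerProductSpace ℝ H]
    [CompleteSpace H] :
    ∃ (Ω : Type u) (_ : MeasurableSpace Ω) (P : Measure Ω) (_ : IsProbabilityMeasure P)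
      (T : H →ₗᵢ[ℝ] Lp ℝ 2 P), ∀ h, P.map (T h) = gaussianReal 0 (‖h‖₊ ^ 2) := by
  obtain ⟨w, b, -⟩ := exists_hilbertBasis ℝ H
  let P : Measure (w → ℝ) := Measure.infinitePi fun _ => gaussianReal 0 1
  have hmap : ∀ i, P.map (fun ω => ω i) = gaussianReal 0 1 := fun i =>
    Measure.infinitePi_map_eval _ i
  have hind : iIndepFun (fun (i : w) (ω : w → ℝ) => ω i) P :=
    iIndepFun_infinitePi (X := fun _ x => x) (fun _ => measurable_id)
  have hmp : ∀ i : w, MeasurePreserving (fun ω : w → ℝ => ω i) P (gaussianReal 0 1) :=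
    fun i => ⟨measurable_pi_apply i, hmap i⟩
  have hL : ∀ i : w, MemLp (fun ω : w → ℝ => ω i) 2 P := fun i =>
    (memLp_id_gaussianReal 2).comp_measurePreserving (hmp i)
  have hint : ∀ i : w, ∫ ω, ω i ∂P = 0 := fun i => by
    have := integral_map (μ := P) (φ := fun ω => ω i) (measurable_pi_apply i).aemeasurable
      (f := fun x : ℝ => x) (by fun_prop)
    rw [hmap, integral_id_gaussianReal] at this
    exact this.symm
  have hint2 : ∀ i : w, ∫ ω, ω i * ω i ∂P = 1 := fun i => by
    have := integral_map (μ := P) (φ := fun ω => ω i) (measurable_pi_apply i).aemeasurable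
      (f := fun x : ℝ => x * x) (by fun_prop)
    rw [hmap] at this
    rw [← this]
    have hv := variance_fun_id_gaussianReal (μ := 0) (v := 1)
    rw [variance_eq_integral (by fun_prop)] at hv
    simpa [pow_two] using hv
  let X : w → Lp ℝ 2 P := fun i => (hL i).toLp
  have hX : ∀ i, X i =ᵐ[P] fun ω => ω i := fun i => (hL i).coeFn_toLp
  have horth : Orthonormal ℝ X := by
    classical
    rw [orthonormal_iff_ite]
    intro i j
    have : ⟪X i, X j⟫_ℝ = ∫ ω, ω j * ω i ∂P := by
      rw [L2.inner_def]
      refine integral_congr_ae ?_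
      filter_upwards [hX i, hX j] with ω h1 h2
      simp [h1, h2]
    rw [this]
    split_ifs with h
    · subst h; exact hint2 i
    · have := (hind.indepFun (Ne.symm h)).integral_fun_mul_eq_mul_integral
        (measurable_pi_apply _).aestronglyMeasurable (measurable_pi_apply _).aestronglyMeasurable
      rw [this, hint, zero_mul]
  let T : H →ₗᵢ[ℝ] Lp ℝ 2 P :=
    horth.orthogonalFamily.linearIsometry.comp b.repr.toLinearIsometry
  refine ⟨w → ℝ, inferInstance, P, inferInstance, T, fun h => ?_⟩
  -- partial sums
  let a : w → ℝ := fun i => b.repr h i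
  have hsum : HasSum (fun i => a i • X i) (T h) :=
    horth.orthogonalFamily.hasSum_linearIsometry (b.repr h)
  have hsq : HasSum (fun i => a i ^ 2) (‖h‖ ^ 2) := by
    have := lp.hasSum_inner (𝕜 := ℝ) (b.repr h) (b.repr h)
    rw [real_inner_self_eq_norm_sq, b.repr.norm_map] at this
    simpa [a, pow_two] using this
  have : IsProbabilityMeasure (P.map (T h)) :=
    Measure.isProbabilityMeasure_map (Lp.aestronglyMeasurable _).aemeasurable
  refine Measure.ext_of_charFun (funext fun t => ?_)
  -- continuity of u ↦ E exp(i t u) on L²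
  let Φ : Lp ℝ 2 P → ℂ := fun u => ∫ ω, Complex.exp (t * u ω * Complex.I) ∂P
  have hΦ : ∀ u : Lp ℝ 2 P, charFun (P.map u) t = Φ u := fun u => by
    rw [charFun_apply_real, integral_map (Lp.aestronglyMeasurable _).aemeasurable (by fun_prop)]
  have hlip : ∀ u u' : Lp ℝ 2 P, ‖Φ u - Φ u'‖ ≤ |t| * ‖u - u'‖ := fun u u' => by
    have hi : ∀ u : Lp ℝ 2 P, Integrable (fun ω => Complex.exp (t * u ω * Complex.I)) P := by
      intro u
      refine Integrable.of_bound (C := 1) ?_ (ae_of_all _ fun ω => ?_)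
      · have := Lp.aestronglyMeasurable u
        exact Continuous.comp_aestronglyMeasurable (g := fun x : ℝ =>
          Complex.exp (t * x * Complex.I)) (by fun_prop) this
      · rw [← Complex.ofReal_mul, Complex.norm_exp_ofReal_mul_I]
    have hm : MemLp (u - u' : Lp ℝ 2 P) 1 P := (Lp.memLp (u - u')).mono_exponent (by norm_num)
    calc ‖Φ u - Φ u'‖ = ‖∫ ω, (Complex.exp (t * u ω * Complex.I)
            - Complex.exp (t * u' ω * Complex.I)) ∂P‖ := by
          rw [integral_sub (hi u) (hi u')]
      _ ≤ ∫ ω, |t| * ‖(u - u' : Lp ℝ 2 P) ω‖ ∂P := by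
          refine norm_integral_le_of_norm_le (hm.integrable le_rfl |>.norm.const_mul _) ?_
          filter_upwards [Lp.coeFn_sub u u'] with ω hω
          have h1 := Real.norm_exp_I_mul_ofReal_sub_one_le (x := t * (u ω - u' ω))
          have h2 : Complex.exp (t * u ω * Complex.I) - Complex.exp (t * u' ω * Complex.I)
              = Complex.exp ((t * u' ω : ℝ) * Complex.I) *
                (Complex.exp (Complex.I * ((t * (u ω - u' ω) : ℝ))) - 1) := by
            rw [mul_sub, mul_one, ← Complex.exp_add]
            push_cast
            ring_nf
          rw [h2, norm_mul, Complex.norm_exp_ofReal_mul_I, one_mul, hω]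
          simpa [abs_mul] using h1
      _ = |t| * ∫ ω, ‖(u - u' : Lp ℝ 2 P) ω‖ ∂P := integral_const_mul _ _
      _ ≤ |t| * ‖u - u'‖ := by
          gcongr
          rw [Lp.norm_def, integral_norm_eq_lintegral_enorm hm.1, ← eLpNorm_one_eq_lintegral_enorm]
          exact ENNReal.toReal_mono (Lp.memLp _).2.ne
            (eLpNorm_le_eLpNorm_of_exponent_le (by norm_num) hm.1)
  have hcont : Continuous Φ :=
    continuous_iff_continuousAt.2 fun u => by
      rw [ContinuousAt, tendsto_iff_norm_sub_tendsto_zero]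
      refine squeeze_zero (fun _ => norm_nonneg _) (fun u' => hlip u' u) ?_
      have : Tendsto (fun u' : Lp ℝ 2 P => |t| * ‖u' - u‖) (𝓝 u) (𝓝 (|t| * ‖u - u‖)) :=
        (Continuous.tendsto (by fun_prop) u)
      simpa using this
  have hfin : ∀ s : Finset w, Φ (∑ i ∈ s, a i • X i)
      = Complex.exp (((-(t ^ 2 / 2) * ∑ i ∈ s, a i ^ 2 : ℝ) : ℂ)) := fun s => by
    rw [← hΦ]
    have h1 : P.map (∑ i ∈ s, a i • X i : Lp ℝ 2 P)
        = P.map (∑ i ∈ s, fun ω : w → ℝ => a i * ω i) := by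
      refine Measure.map_congr ?_
      refine (Lp.coeFn_finsetSum s (fun i => a i • X i)).trans ?_
      refine eventuallyEq_sum fun i _ => ?_
      filter_upwards [Lp.coeFn_smul (a i) (X i), hX i] with ω h1 h2
      simp [h1, h2]
    have h2 : iIndepFun (fun (i : w) (ω : w → ℝ) => a i * ω i) P :=
      iIndepFun_infinitePi (X := fun i x => a i * x) (fun _ => by fun_prop)
    have hmi : ∀ i : w, Measurable fun ω : w → ℝ => a i * ω i := fun i =>
      Measurable.mul (f := fun _ : w → ℝ => a i) measurable_const (measurable_pi_apply i)
    rw [h1, iIndepFun.charFun_map_finsetSum_eq_prod 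
      (fun i _ => (hmi i).aemeasurable) (h2.restrict s)]
    have h3 : ∀ i, P.map (fun ω : w → ℝ => a i * ω i)
        = gaussianReal 0 (NNReal.mk (a i ^ 2) (sq_nonneg _)) := fun i => by
      have := Measure.map_map (μ := P) (g := fun x : ℝ => a i * x) (f := fun ω => ω i)
        (by fun_prop) (by fun_prop)
      rw [hmap, gaussianReal_map_const_mul] at this
      simpa [Function.comp_def] using this.symm
    simp only [h3, Finset.prod_apply, charFun_gaussianReal]
    rw [← Complex.exp_sum]
    congr 1
    push_cast
    rw [Finset.mul_sum]
    refine Finset.sum_congr rfl fun i _ => ?_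
    simp
    ring
  have l1 : Tendsto (fun s : Finset w => Φ (∑ i ∈ s, a i • X i)) atTop (𝓝 (Φ (T h))) :=
    (hcont.tendsto _).comp hsum
  have l2 : Tendsto (fun s : Finset w => Φ (∑ i ∈ s, a i • X i)) atTop
      (𝓝 (Complex.exp ((-(t ^ 2 / 2) * ‖h‖ ^ 2 : ℝ) : ℂ))) := by
    simp only [hfin]
    have hc : Continuous fun x : ℝ => Complex.exp ((-(t ^ 2 / 2) * x : ℝ) : ℂ) := by fun_prop
    exact (hc.tendsto _).comp hsq
  rw [hΦ, tendsto_nhds_unique l1 l2, charFun_gaussianReal]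
  congr 1
  push_cast
  simp
  ring

theorem exists_isHatGaussian {E H : Type*} [SeminormedAddCommGroup E] [NormedSpace ℝ E]
    [NormedAddCommGroup H] [InnerProductSpace ℝ H] [CompleteSpace H]
    (A : StrongDual ℝ E →ₗᵢ[ℝ] H) (v : ℝ≥0) :
    ∃ ν : Measure (Hat E), IsHatGaussian ν v := by
  obtain ⟨Ω, _, P, _, T, hT⟩ := exists_isonormal H
  let b := Module.Basis.ofVectorSpace ℝ (StrongDual ℝ E)
  have hm : ∀ u : Lp ℝ 2 P, ∃ g : Ω → ℝ, Measurable g ∧ u =ᵐ[P] g := fun u =>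
    ⟨_, (Lp.aestronglyMeasurable u).stronglyMeasurable_mk.measurable,
      (Lp.aestronglyMeasurable u).ae_eq_mk⟩
  choose g hg1 hg2 using hm
  let S : Ω → Hat E := fun ω => b.constr ℝ fun k => g (T (A (b k))) ω
  have hS : ∀ f ω, S ω f = (b.repr f).sum fun k c => c * g (T (A (b k))) ω := fun f ω => by
    simp [S, Module.Basis.constr_apply]
  have hSm : Measurable S := measurable_toHat fun f => by
    simp only [hS, Finsupp.sum]
    exact Finset.measurable_sum _ fun k _ => (hg1 _).const_mul _
  have hSf : ∀ f, (fun ω => S ω f) =ᵐ[P] T (A f) := fun f => by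
    have h1 : T (A f) = ∑ k ∈ (b.repr f).support, (b.repr f k) • T (A (b k)) := by
      conv_lhs => rw [← b.linearCombination_repr f]
      simp [Finsupp.linearCombination_apply, Finsupp.sum]
    rw [h1]
    refine EventuallyEq.trans ?_ (Lp.coeFn_finsetSum _ _).symm
    have h2 : (fun ω => S ω f)
        = ∑ k ∈ (b.repr f).support, fun ω => b.repr f k * g (T (A (b k))) ω := by
      ext ω; simp [hS, Finsupp.sum]
    rw [h2]
    refine eventuallyEq_sum fun i _ => ?_
    filter_upwards [Lp.coeFn_smul (b.repr f i) (T (A (b i))), hg2 (T (A (b i)))] with ω h1 h2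
    simp [h1, h2]
  refine ⟨P.map fun ω => (NNReal.sqrt v : ℝ) • S ω, fun f => ?_⟩
  have hm2 : Measurable fun ω => (NNReal.sqrt v : ℝ) • S ω := measurable_toHat fun f => by
    simpa using ((measurable_eval f).comp hSm).const_mul _
  rw [Measure.map_map (measurable_eval f) hm2]
  have : ((fun x : Hat E => x f) ∘ fun ω => (NNReal.sqrt v : ℝ) • S ω)
      = (fun x => (NNReal.sqrt v : ℝ) * x) ∘ fun ω => S ω f := by
    ext ω; simp
  rw [this, ← Measure.map_map (measurable_const_mul _)
      (show Measurable fun ω => S ω f from (measurable_eval f).comp hSm),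
    Measure.map_congr (hSf f), hT, gaussianReal_map_const_mul, A.nnnorm_map]
  congr 1
  · simp
  · ext; simp

variable {L : Type*} [NormedAddCommGroup L] [InnerProductSpace ℝ L]

/-- A linear field theory: the real vector space `L` of solutions, the symplectic potential
`[·,·]` and a compatible complex structure `J`.  The form `g(τ, ξ) = 2 ω(τ, J ξ)` is the inner
product of `L`, where `ω(ξ, ξ') = ([ξ, ξ'] - [ξ', ξ]) / 2` is the symplectic form. -/
structure FieldTheory (L : Type*) [NormedAddCommGroup L] [InnerProductSpace ℝ L] where
  bracket : L →L[ℝ] L →L[ℝ] ℝ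
  J : L →ₗ[ℝ] L
  nondegenerate : ∀ τ, (∀ ξ, 1 / 2 * bracket τ ξ - 1 / 2 * bracket ξ τ = 0) → τ = 0
  /-- `L` is the sum of the subspaces `M` and `N`. -/
  decomposition : ∀ ξ, ∃ m n, (∀ ζ, bracket ζ m = 0) ∧ (∀ ζ, bracket n ζ = 0) ∧ m + n = ξ
  J_sq : ∀ ξ, J (J ξ) = -ξ
  J_symplectic : ∀ τ ξ, 1 / 2 * bracket (J τ) (J ξ) - 1 / 2 * bracket (J ξ) (J τ)
    = 1 / 2 * bracket τ ξ - 1 / 2 * bracket ξ τ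
  inner_eq : ∀ τ ξ, ⟪τ, ξ⟫_ℝ = 2 * (1 / 2 * bracket τ (J ξ) - 1 / 2 * bracket (J ξ) τ)

namespace FieldTheory

variable (T : FieldTheory L)

/-- The symplectic form. -/
def omega (τ : L) : L →L[ℝ] ℝ := (1 / 2 : ℝ) • T.bracket τ - (1 / 2 : ℝ) • T.bracket.flip τ

theorem omega_apply (τ ξ : L) :
    T.omega τ ξ = 1 / 2 * T.bracket τ ξ - 1 / 2 * T.bracket ξ τ := by
  simp [omega]

theorem omega_swap (τ ξ : L) : T.omega τ ξ = -T.omega ξ τ := by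
  simp only [omega_apply]; ring

theorem omega_J_J (τ ξ : L) : T.omega (T.J τ) (T.J ξ) = T.omega τ ξ := by
  simp only [omega_apply, T.J_symplectic]

theorem inner_eq_omega (τ ξ : L) : ⟪τ, ξ⟫_ℝ = 2 * T.omega τ (T.J ξ) := by
  rw [T.inner_eq, omega_apply]

/-- The hermitian inner product `{τ, ξ} = g(τ, ξ) + 2 i ω(τ, ξ)`. -/
def herm (τ : L) : L →L[ℝ] ℂ :=
  Complex.ofRealCLM.comp (innerSL ℝ τ) + (2 * Complex.I) • Complex.ofRealCLM.comp (T.omega τ)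

theorem herm_apply (τ ξ : L) : T.herm τ ξ = (⟪τ, ξ⟫_ℝ : ℂ) + 2 * Complex.I * T.omega τ ξ := by
  simp [herm]

/-- The subspace `M = {τ | [ξ, τ] = 0 for all ξ}` of momentum directions. -/
def M : Submodule ℝ L where
  carrier := {τ | ∀ ξ, T.bracket ξ τ = 0}
  add_mem' ha hb ξ := by simp [ha ξ, hb ξ]
  zero_mem' ξ := by simp
  smul_mem' c a ha ξ := by simp [ha ξ]

theorem mem_M {τ : L} : τ ∈ T.M ↔ ∀ ξ, T.bracket ξ τ = 0 := Iff.rfl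

theorem isClosed_M : IsClosed (T.M : Set L) := by
  have : (T.M : Set L) = ⋂ ξ, {τ | T.bracket ξ τ = 0} := by ext; simp [mem_M]
  rw [this]
  exact isClosed_iInter fun ξ => isClosed_eq (by fun_prop) continuous_const

/-- The space `Q = L / M` of field configurations, with the quotient norm. -/
abbrev Q : Type _ := L ⧸ T.M

/-- The quotient map `L → Q`. -/
abbrev q (ξ : L) : T.Q := T.M.mkQ ξ

/-- The symplectic potential as a map `L × Q → ℝ`. -/
def bracketQ (ξ : L) : T.Q →L[ℝ] ℝ :=
  T.M.liftQL (T.bracket ξ) fun _ hm => T.mem_M.1 hm ξ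

theorem bracketQ_q (ξ τ : L) : T.bracketQ ξ (T.q τ) = T.bracket ξ τ := rfl

/-- The subspace `J M`. -/
def JM : Submodule ℝ L := T.M.map T.J

theorem mem_M_of_omega {ξ : L} (h : ∀ m ∈ T.M, T.omega m ξ = 0) : ξ ∈ T.M := by
  obtain ⟨m, n, hm, hn, rfl⟩ := T.decomposition ξ
  have hn0 : n = 0 := by
    refine T.nondegenerate n fun ζ => ?_
    obtain ⟨m', n', hm', hn', rfl⟩ := T.decomposition ζ
    have := h m' hm'
    simp only [omega_apply, map_add, hm, hm', hn, add_apply] at this ⊢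
    simp [hn'] at this ⊢
    linarith
  rw [hn0, add_zero]
  exact hm

theorem JM_eq : T.JM = T.Mᗮ := by
  ext ξ
  rw [Submodule.mem_orthogonal]
  constructor
  · rintro ⟨m, hm, rfl⟩ m' hm'
    rw [T.inner_eq_omega, T.J_sq, map_neg, T.omega_apply, hm m', hm' m]
    simp
  · intro h
    refine ⟨-T.J ξ, T.M.neg_mem (T.mem_M_of_omega fun m hm => ?_), by simp [T.J_sq]⟩
    have := h m hm
    rw [T.inner_eq_omega] at this
    linarith

theorem herm_J (τ ξ : L) : T.herm τ (T.J ξ) = Complex.I * T.herm τ ξ := by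
  have h1 := T.inner_eq_omega τ (T.J ξ)
  have h2 := T.inner_eq_omega τ ξ
  rw [T.J_sq, map_neg] at h1
  rw [herm_apply, herm_apply, h1, h2]
  push_cast
  linear_combination (2 * (T.omega τ ξ : ℂ)) * Complex.I_sq.symm

variable [CompleteSpace L]

theorem isCompl_M_JM : IsCompl T.M T.JM := by
  have : CompleteSpace T.M := T.isClosed_M.completeSpace_coe
  rw [JM_eq]
  exact T.M.isCompl_orthogonal

/-- The unique linear map `j : Q → L` with `q ∘ j = id` and `j(Q) ⊆ J M`. -/
def jLin : T.Q →ₗ[ℝ] L := T.JM.subtype ∘ₗ (T.M.quotientEquivOfIsCompl T.JM T.isCompl_M_JM).toLinearMap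

theorem jLin_mem (φ : T.Q) : T.jLin φ ∈ T.JM := Subtype.property _

theorem q_jLin (φ : T.Q) : T.q (T.jLin φ) = φ :=
  Submodule.mk_quotientEquivOfIsCompl_apply T.isCompl_M_JM φ

theorem jLin_q_sub_mem (ξ : L) : ξ - T.jLin (T.q ξ) ∈ T.M :=
  (Submodule.Quotient.eq _).1 (T.q_jLin (T.q ξ)).symm

theorem norm_jLin_q_le (ξ : L) : ‖T.jLin (T.q ξ)‖ ≤ ‖ξ‖ := by
  have h1 : ⟪ξ - T.jLin (T.q ξ), T.jLin (T.q ξ)⟫_ℝ = 0 := by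
    have h := T.jLin_mem (T.q ξ)
    rw [JM_eq, Submodule.mem_orthogonal] at h
    exact h _ (T.jLin_q_sub_mem ξ)
  have h2 := norm_add_sq_eq_norm_sq_add_norm_sq_of_inner_eq_zero _ _ h1
  rw [sub_add_cancel] at h2
  nlinarith [norm_nonneg ξ, norm_nonneg (T.jLin (T.q ξ)),
    mul_self_nonneg ‖ξ - T.jLin (T.q ξ)‖]

theorem norm_jLin_le (φ : T.Q) : ‖T.jLin φ‖ ≤ ‖φ‖ := by
  refine le_of_forall_pos_le_add fun ε hε => ?_
  obtain ⟨m, rfl, hm⟩ := Submodule.Quotient.norm_mk_lt φ hε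
  exact (T.norm_jLin_q_le m).trans hm.le

/-- The map `j` as a continuous linear map. -/
def j : T.Q →L[ℝ] L := T.jLin.mkContinuous 1 fun φ => by simpa using T.norm_jLin_le φ

theorem norm_j (φ : T.Q) : ‖T.j φ‖ = ‖φ‖ := by
  refine le_antisymm (T.norm_jLin_le φ) ?_
  conv_lhs => rw [← T.q_jLin φ]
  exact Submodule.Quotient.norm_mk_le (S := T.M) (T.jLin φ)

/-- The symmetric bilinear form `Ω(φ, φ') = g(j φ, j φ') - i [j φ, φ']` on `Q`. -/
def Omega (φ : T.Q) : T.Q →L[ℝ] ℂ :=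
  Complex.ofRealCLM.comp ((innerSL ℝ (T.j φ)).comp T.j)
    - Complex.I • Complex.ofRealCLM.comp (T.bracketQ (T.j φ))

theorem Omega_apply (φ φ' : T.Q) :
    T.Omega φ φ' = (⟪T.j φ, T.j φ'⟫_ℝ : ℂ) - Complex.I * T.bracketQ (T.j φ) φ' := by
  simp [Omega]

/-- Pulling back along `q` embeds the dual of `Q` isometrically into the Hilbert space `L`. -/
def dualEmbedding : StrongDual ℝ T.Q →ₗᵢ[ℝ] L where
  toFun f := (InnerProductSpace.toDual ℝ L).symm (f.comp T.M.mkQL)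
  map_add' f f' := by rw [ContinuousLinearMap.add_comp, map_add]
  map_smul' c f := by rw [ContinuousLinearMap.smul_comp, map_smulₛₗ]; rfl
  norm_map' f := by
    change ‖(InnerProductSpace.toDual ℝ L).symm (f.comp T.M.mkQL)‖ = ‖f‖
    rw [LinearIsometryEquiv.norm_map]
    refine le_antisymm ?_ ?_
    · refine ContinuousLinearMap.opNorm_le_bound _ (norm_nonneg f) fun ξ => ?_
      refine (f.le_opNorm _).trans ?_
      gcongr
      exact Submodule.Quotient.norm_mk_le (S := T.M) ξ
    · refine ContinuousLinearMap.opNorm_le_bound _ (norm_nonneg _) fun φ => ?_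
      have h : f φ = (f.comp T.M.mkQL) (T.jLin φ) := congrArg f (T.q_jLin φ).symm
      rw [h]
      refine (ContinuousLinearMap.le_opNorm _ _).trans ?_
      gcongr
      exact T.norm_jLin_le φ

/-- The Gaussian measure `dν_Q = exp (- Re Ω(φ, φ)) dμ_Q` on `Hat Q`. -/
def nuQ : Measure (Hat T.Q) := (exists_isHatGaussian T.dualEmbedding (1 / 2)).choose

theorem isHatGaussian_nuQ : IsHatGaussian T.nuQ (1 / 2) :=
  (exists_isHatGaussian T.dualEmbedding (1 / 2)).choose_spec

/-- The Gaussian measure `dν_L = exp (- g(ξ, ξ) / 2) dμ_L` on `Hat L`. -/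
def nuL (_T : FieldTheory L) : Measure (Hat L) := (exists_isHatGaussian
  (InnerProductSpace.toDual ℝ L).symm.toLinearIsometry 1).choose

theorem isHatGaussian_nuL : IsHatGaussian T.nuL 1 :=
  (exists_isHatGaussian (InnerProductSpace.toDual ℝ L).symm.toLinearIsometry 1).choose_spec

/-- The Hilbert space `L²(Hat Q, ν_Q)` of reduced Schrödinger wave functions. -/
abbrev HS : Type _ := Lp ℂ 2 T.nuQ

/-- The reduced Schrödinger wave function `k_τ` of the normalized coherent state of `τ`:
`k_τ(φ) = exp (Ω(q τ, φ) + i [τ, φ] - Ω(q τ, q τ) / 2 - i [τ, τ] / 2)`. -/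
def schrCoherent (τ : L) (φ : Hat T.Q) : ℂ :=
  Complex.exp (ext (T.Omega (T.q τ) + Complex.I • Complex.ofRealCLM.comp (T.bracketQ τ)) φ
    + (-(1 / 2) * T.Omega (T.q τ) (T.q τ) - Complex.I / 2 * T.bracket τ τ))

/-- The element of `L²(Hat Q, ν_Q)` given by `k_τ`. -/
def schrCoherentState (τ : L) : T.HS := (T.isHatGaussian_nuQ.memLp_exp
  (T.Omega (T.q τ) + Complex.I • Complex.ofRealCLM.comp (T.bracketQ τ))
  (-(1 / 2) * T.Omega (T.q τ) (T.q τ) - Complex.I / 2 * T.bracket τ τ)).toLp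

/-- Holomorphic functions on `Hat L` that are induced from a finite-dimensional complex quotient
of `(L, J)`: holomorphic functions of finitely many continuous complex-linear functionals. -/
def IsCylHolomorphic (ψ : Hat L → ℂ) : Prop :=
  ∃ (n : ℕ) (l : Fin n → L →L[ℝ] ℂ) (h : (Fin n → ℂ) → ℂ),
    (∀ i ξ, l i (T.J ξ) = Complex.I * l i ξ) ∧ Differentiable ℂ h ∧
      ψ = fun x => h fun i => ext (l i) x

/-- The Hilbert space `H²(Hat L, ν_L)` of square-integrable holomorphic functions: the closure in
`L²(Hat L, ν_L)` of the square-integrable cylindrical holomorphic functions. -/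
def HH : Submodule ℂ (Lp ℂ 2 T.nuL) :=
  (Submodule.span ℂ {u : Lp ℂ 2 T.nuL | ∃ ψ, T.IsCylHolomorphic ψ ∧ u =ᵐ[T.nuL] ψ}).topologicalClosure

/-- The wave function `K_τ(ξ) = exp ({τ, ξ} / 2)` on `L` of the coherent state of `τ`. -/
def holCoherent (τ ξ : L) : ℂ := Complex.exp (1 / 2 * T.herm τ ξ)

/-- The extension of `K_τ` to `Hat L`, as an element of `L²(Hat L, ν_L)`. -/
def holCoherentLp (τ : L) : Lp ℂ 2 T.nuL :=
  (T.isHatGaussian_nuL.memLp_exp ((1 / 2 : ℂ) • T.herm τ) 0).toLp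

theorem holCoherentLp_mem (τ : L) : T.holCoherentLp τ ∈ T.HH := by
  refine Submodule.le_topologicalClosure _ (Submodule.subset_span
    ⟨_, ⟨1, fun _ => (1 / 2 : ℂ) • T.herm τ, fun z => Complex.exp (z 0), ?_, by fun_prop, rfl⟩, ?_⟩)
  · intro _ ξ
    simp only [FunLike.coe_smul, Pi.smul_apply, smul_eq_mul, herm_J]
    ring
  · refine (MemLp.coeFn_toLp _).trans (ae_of_all _ fun x => ?_)
    simp

/-- The coherent state `K_τ` in the holomorphic representation. -/
def holCoherentState (τ : L) : T.HH := ⟨T.holCoherentLp τ, T.holCoherentLp_mem τ⟩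

/-- The normalized coherent state `exp (- g(τ, τ) / 4) K_τ`. -/
def holNormalizedState (τ : L) : T.HH :=
  Complex.exp (-(1 / 4) * (⟪τ, τ⟫_ℝ : ℂ)) • T.holCoherentState τ

/-- The wave function on `L` of a state in the holomorphic representation.  By the reproducing
property of the coherent states its value at `τ` is the inner product with `K_τ`. -/
def wave : T.HH →ₗ[ℂ] (L → ℂ) :=
  LinearMap.pi fun τ => (innerSL ℂ (T.holCoherentState τ)).toLinearMap

theorem wave_apply (u : T.HH) (τ : L) : T.wave u τ = ⟪T.holCoherentState τ, u⟫_ℂ := rfl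

/-- The Hamiltonian vector field of a continuous linear observable `F`: the `X_F ∈ L` with
`2 ω(ξ, X_F) = F ξ` for all `ξ`. -/
def ham (F : StrongDual ℝ L) : L := T.J ((InnerProductSpace.toDual ℝ L).symm F)

theorem two_mul_omega_ham (F : StrongDual ℝ L) (ξ : L) : 2 * T.omega ξ (T.ham F) = F ξ := by
  rw [ham, ← T.inner_eq_omega, real_inner_comm, InnerProductSpace.toDual_symm_apply]

/-- Quantization of `F` on reduced Schrödinger wave functions:
`(F̌ ψ)(φ) = (- [X_F, φ] + i Ω(q X_F, φ)) ψ(φ) - i (D_{X_F} ψ)(φ)`. -/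
def schrQuant (F : StrongDual ℝ L) (ψ : Hat T.Q → ℂ) (φ : Hat T.Q) : ℂ :=
  ext (-Complex.ofRealCLM.comp (T.bracketQ (T.ham F)) + Complex.I • T.Omega (T.q (T.ham F))) φ
      * ψ φ
    - Complex.I * lineDeriv ℝ ψ φ (incl (T.q (T.ham F)))

/-- The holomorphic part `F⁺(ξ) = (F ξ - i F (J ξ)) / 2`. -/
def holPart (F : StrongDual ℝ L) (ξ : L) : ℂ := 1 / 2 * (F ξ - Complex.I * F (T.J ξ))

/-- The anti-holomorphic part `F⁻(ξ) = (F ξ + i F (J ξ)) / 2`. -/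
def antiholPart (F : StrongDual ℝ L) (ξ : L) : ℂ := 1 / 2 * (F ξ + Complex.I * F (T.J ξ))

/-- The Hamiltonian vector field of `F⁻` is `(X_F - i J X_F) / 2`. -/
theorem two_mul_omega_antihol (F : StrongDual ℝ L) (ξ : L) :
    2 * (1 / 2 * ((T.omega ξ (T.ham F) : ℂ) - Complex.I * T.omega ξ (T.J (T.ham F))))
      = T.antiholPart F ξ := by
  have h : T.omega ξ (T.J (T.ham F)) = -T.omega (T.J ξ) (T.ham F) := by
    have := T.omega_J_J (T.J ξ) (T.ham F)
    rw [T.J_sq, T.omega_swap (-ξ), map_neg, T.omega_swap _ ξ] at this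
    linarith
  rw [antiholPart, ← T.two_mul_omega_ham F ξ, ← T.two_mul_omega_ham F (T.J ξ), h]
  push_cast
  ring

/-- Quantization of `F` on holomorphic wave functions:
`(F̌ ψ)(ξ) = F⁺(ξ) ψ(ξ) - i (D_{X_{F⁻}} ψ)(ξ)`, where `X_{F⁻} = (X_F - i J X_F) / 2`. -/
def holQuant (F : StrongDual ℝ L) (ψ : L → ℂ) (ξ : L) : ℂ :=
  T.holPart F ξ * ψ ξ
    - Complex.I * (1 / 2 * (lineDeriv ℝ ψ ξ (T.ham F)
        - Complex.I * lineDeriv ℝ ψ ξ (T.J (T.ham F))))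

/-- The functions on `Hat Q` generated by the action of products of continuous linear observables
on the reduced wave functions of coherent states. -/
def schrCPFun : Submodule ℂ (Hat T.Q → ℂ) :=
  Submodule.span ℂ (Set.range fun p : List (StrongDual ℝ L) × L =>
    p.1.foldr T.schrQuant (T.schrCoherent p.2))

/-- The functions on `L` generated by the action of products of continuous linear observables
on the holomorphic wave functions of coherent states. -/
def holCPFun : Submodule ℂ (L → ℂ) :=
  Submodule.span ℂ (Set.range fun p : List (StrongDual ℝ L) × L =>
    p.1.foldr T.holQuant (T.holCoherent p.2))

/-- The states in `L²(Hat Q, ν_Q)` given by the functions in `schrCPFun`. -/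
def HScp : Submodule ℂ T.HS where
  carrier := {u | ∃ ψ ∈ T.schrCPFun, u =ᵐ[T.nuQ] ψ}
  add_mem' := by
    rintro u v ⟨ψ, hψ, hu⟩ ⟨χ, hχ, hv⟩
    exact ⟨ψ + χ, add_mem hψ hχ, (Lp.coeFn_add u v).trans (hu.add hv)⟩
  zero_mem' := ⟨0, zero_mem _, Lp.coeFn_zero _ _ _⟩
  smul_mem' := by
    rintro c u ⟨ψ, hψ, hu⟩
    exact ⟨c • ψ, Submodule.smul_mem _ c hψ, (Lp.coeFn_smul c u).trans (hu.const_smul c)⟩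

/-- The holomorphic states with wave function in `holCPFun`. -/
def HHcp : Submodule ℂ T.HH := T.holCPFun.comap T.wave

end FieldTheory

end
end OecklQuantization

/-!
The coherent states have the same Gram matrix
`exp ({τ, σ} / 2 - g(τ, τ) / 4 - g(σ, σ) / 4)` in both representations and are total in both
spaces, so `k_τ ↦ exp (-g(τ, τ) / 4) K_τ` extends to a unique isometric isomorphism.  In
`L²(Hat Q, ν_Q)` totality is the injectivity of the Fourier transform: for `τ ∈ M` the function
`k_τ` is a character, and every character is of this form.  In `H²(Hat L, ν_L)` it follows from
the reproducing property, which is the mean value property of holomorphic functions averaged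
against the circle invariant measure `ν_L`.

For the observables, let `E_X` be the linear exponent of `k_X`.  By the Cameron–Martin formula the
inner product of `k_σ` with `exp (t E_X) ψ(· - t q X)` is an explicit Gaussian factor times the
inner product of `k_{σ - t X}` with `ψ`, which is the holomorphic wave function of `ψ` at
`σ - t X` up to normalization.  The derivatives of the two sides in `t = 0` for `X = X_F` are the
two quantizations of `F`.
-/

namespace OecklQuantization
noncomputable section

/-! ### The space `Hat E` -/

section hat
variable {E E' : Type*} [SeminormedAddCommGroup E] [NormedSpace ℝ E] [SeminormedAddCommGroup E']
  [NormedSpace ℝ E']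

theorem measurable_exp_eval_mul_I (f : StrongDual ℝ E) :
    Measurable fun x : Hat E => Complex.exp (x f * Complex.I) :=
  Complex.measurable_exp.comp
    ((Complex.measurable_ofReal.comp (measurable_eval f)).mul_const Complex.I)

theorem measurable_ext (l : E →L[ℝ] ℂ) : Measurable fun x : Hat E => ext l x :=
  (Complex.measurable_ofReal.comp (measurable_eval _)).add
    ((Complex.measurable_ofReal.comp (measurable_eval _)).mul_const _)

theorem measurable_add_right_hat (y : Hat E) : Measurable fun x : Hat E => x + y :=
  measurable_toHat fun f => by simpa using (measurable_eval f).add_const (y f)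

theorem ext_add (l l' : E →L[ℝ] ℂ) (x : Hat E) : ext (l + l') x = ext l x + ext l' x := by
  simp only [ext, ContinuousLinearMap.comp_add, map_add]
  push_cast
  ring

theorem ext_smul (c : ℂ) (l : E →L[ℝ] ℂ) (x : Hat E) : ext (c • l) x = c * ext l x := by
  have hre : Complex.reCLM.comp (c • l)
      = c.re • Complex.reCLM.comp l - c.im • Complex.imCLM.comp l := by
    ext; simp
  have him : Complex.imCLM.comp (c • l)
      = c.re • Complex.imCLM.comp l + c.im • Complex.reCLM.comp l := by
    ext; simp
  apply Complex.ext <;> simp [ext, hre, him]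

theorem ext_sum {ι : Type*} (s : Finset ι) (l : ι → E →L[ℝ] ℂ) (x : Hat E) :
    ext (∑ i ∈ s, l i) x = ∑ i ∈ s, ext (l i) x :=
  map_sum (AddMonoidHom.mk' (fun l : E →L[ℝ] ℂ => ext l x) fun l l' => ext_add l l' x) l s

theorem ext_add_right (l : E →L[ℝ] ℂ) (x y : Hat E) : ext l (x + y) = ext l x + ext l y := by
  simp only [ext, LinearMap.add_apply]
  push_cast
  ring

theorem ext_smul_right (l : E →L[ℝ] ℂ) (c : ℝ) (x : Hat E) : ext l (c • x) = c * ext l x := by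
  simp only [ext, LinearMap.smul_apply, smul_eq_mul]
  push_cast
  ring

theorem ext_ofReal_comp (f : StrongDual ℝ E) (x : Hat E) :
    ext (Complex.ofRealCLM.comp f) x = x f := by
  have hre : Complex.reCLM.comp (Complex.ofRealCLM.comp f) = f := by ext; simp
  have him : Complex.imCLM.comp (Complex.ofRealCLM.comp f) = 0 := by ext; simp
  simp [ext, hre, him]

/-- The linear map `Hat E → Hat E'` extending a continuous linear map `A : E → E'`. -/
def hatMap (A : E →L[ℝ] E') : Hat E →ₗ[ℝ] Hat E' :=
  ((ContinuousLinearMap.compL ℝ E E' ℝ).flip A).toLinearMap.dualMap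

theorem hatMap_apply (A : E →L[ℝ] E') (x : Hat E) (f : StrongDual ℝ E') :
    hatMap A x f = x (f.comp A) := rfl

theorem measurable_hatMap (A : E →L[ℝ] E') : Measurable (hatMap A) :=
  measurable_toHat fun f => measurable_eval (f.comp A)

theorem ext_hatMap (l : E' →L[ℝ] ℂ) (A : E →L[ℝ] E') (x : Hat E) :
    ext l (hatMap A x) = ext (l.comp A) x := rfl

end hat

/-! ### Finite measures and integrable functions on `Hat E` are determined by Fourier transforms -/

section fourier
variable {E : Type*} [SeminormedAddCommGroup E] [NormedSpace ℝ E] {μ ν : Measure (Hat E)}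

theorem measurableSpace_hat_eq_comap :
    (instMeasurableSpaceHat : MeasurableSpace (Hat E))
      = MeasurableSpace.comap (fun (x : Hat E) (f : StrongDual ℝ E) => x f) inferInstance := by
  simp only [instMeasurableSpaceHat, MeasurableSpace.pi, MeasurableSpace.comap_iSup,
    MeasurableSpace.comap_comp]
  rfl

theorem measurable_eval_pi : Measurable fun (x : Hat E) (f : StrongDual ℝ E) => x f :=
  measurable_pi_lambda _ measurable_eval

open scoped Classical in
theorem charFunDual_map_restrict_eval (I : Finset (StrongDual ℝ E))
    (l : StrongDual ℝ (I → ℝ)) :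
    charFunDual ((μ.map fun (x : Hat E) (f : StrongDual ℝ E) => x f).map I.restrict) l
      = ∫ x : Hat E, Complex.exp
          (x (∑ f : I, l (Pi.single f 1) • (f : StrongDual ℝ E)) * Complex.I) ∂μ := by
  have hl (y : I → ℝ) : l y = ∑ f, l (Pi.single f 1) * y f := by
    conv_lhs => rw [← Finset.univ_sum_single y, map_sum]
    refine Finset.sum_congr rfl fun f _ => ?_
    rw [mul_comm, ← smul_eq_mul, ← map_smul, ← Pi.single_smul, smul_eq_mul, mul_one]
  rw [Measure.map_map (by fun_prop) measurable_eval_pi, charFunDual_apply,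
    integral_map ((Finset.measurable_restrict I).comp measurable_eval_pi).aemeasurable
      (by fun_prop)]
  congr with x
  rw [hl]
  simp

/-- The vector `(x f₁, …, x fₙ)` is a linear image of `x`, so its characteristic function is
obtained from the integrals of `exp (i x f)`. -/
theorem measure_hat_ext_of_integral_exp [IsFiniteMeasure μ] [IsFiniteMeasure ν]
    (h : ∀ f : StrongDual ℝ E, ∫ x : Hat E, Complex.exp (x f * Complex.I) ∂μ
      = ∫ x : Hat E, Complex.exp (x f * Complex.I) ∂ν) : μ = ν := by
  let ev : Hat E → StrongDual ℝ E → ℝ := fun x f => x f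
  have hev : Measurable ev := measurable_eval_pi
  have hmap : μ.map ev = ν.map ev := by
    refine IsProjectiveLimit.unique (P := fun I => (ν.map ev).map I.restrict) (fun I => ?_)
      fun I => rfl
    refine Measure.ext_of_charFunDual (funext fun l => ?_)
    rw [charFunDual_map_restrict_eval, charFunDual_map_restrict_eval, h]
  ext s hs
  rw [measurableSpace_hat_eq_comap] at hs
  obtain ⟨t, ht, rfl⟩ := hs
  change μ (ev ⁻¹' t) = ν (ev ⁻¹' t)
  rw [← Measure.map_apply hev ht, hmap, Measure.map_apply hev ht]

theorem measure_hat_ext_of_map_eval [IsFiniteMeasure μ] [IsFiniteMeasure ν]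
    (h : ∀ f : StrongDual ℝ E, μ.map (fun x : Hat E => x f) = ν.map fun x : Hat E => x f) :
    μ = ν := by
  refine measure_hat_ext_of_integral_exp fun f => ?_
  have hmap (ρ : Measure (Hat E)) : ∫ x : Hat E, Complex.exp (x f * Complex.I) ∂ρ
      = ∫ y : ℝ, Complex.exp (y * Complex.I) ∂(ρ.map fun x : Hat E => x f) := by
    rw [integral_map (measurable_eval f).aemeasurable (by fun_prop)]
  rw [hmap, hmap, h]

theorem integrable_exp_eval_mul_I_mul {u : Hat E → ℂ} (hu : Integrable u μ)
    (f : StrongDual ℝ E) :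
    Integrable (fun x : Hat E => Complex.exp (x f * Complex.I) * u x) μ :=
  hu.bdd_mul (c := 1) (measurable_exp_eval_mul_I f).aestronglyMeasurable
    (ae_of_all _ fun x => (Complex.norm_exp_ofReal_mul_I (x f)).le)

theorem integral_exp_eval_mul_I_withDensity_ofReal {u : Hat E → ℝ} (hu : Integrable u μ)
    (f : StrongDual ℝ E) :
    ∫ x : Hat E, Complex.exp (x f * Complex.I) ∂(μ.withDensity fun x => ENNReal.ofReal (u x))
      = ∫ x : Hat E, Complex.exp (x f * Complex.I) * (max (u x) 0 : ℝ) ∂μ := by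
  rw [integral_withDensity_eq_integral_toReal_smul₀ hu.1.aemeasurable.ennreal_ofReal
    (ae_of_all _ fun _ => ENNReal.ofReal_lt_top)]
  refine integral_congr_ae (ae_of_all _ fun x => ?_)
  simp only [ENNReal.toReal_ofReal', Complex.real_smul, mul_comm]

/-- The measures with densities `u⁺` and `u⁻` have the same Fourier transform. -/
theorem ae_eq_zero_of_integral_exp_mul_ofReal {u : Hat E → ℝ} (hu : Integrable u μ)
    (h : ∀ f : StrongDual ℝ E, ∫ x : Hat E, Complex.exp (x f * Complex.I) * (u x : ℂ) ∂μ = 0) :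
    u =ᵐ[μ] 0 := by
  have hneg : Integrable (fun x => -u x) μ := hu.neg
  have := isFiniteMeasure_withDensity_ofReal hu.2
  have := isFiniteMeasure_withDensity_ofReal hneg.2
  have hparts : (μ.withDensity fun x => ENNReal.ofReal (u x))
      = μ.withDensity fun x => ENNReal.ofReal (-u x) := by
    refine measure_hat_ext_of_integral_exp fun f => ?_
    rw [integral_exp_eval_mul_I_withDensity_ofReal hu,
      integral_exp_eval_mul_I_withDensity_ofReal hneg, ← sub_eq_zero,
      ← integral_sub
        (integrable_exp_eval_mul_I_mul (u := fun x => (max (u x) 0 : ℝ)) hu.pos_part.ofReal f)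
        (integrable_exp_eval_mul_I_mul (u := fun x => (max (-u x) 0 : ℝ)) hneg.pos_part.ofReal f),
      ← h f]
    congr with x
    rw [← mul_sub, ← Complex.ofReal_sub]
    congr 2
    exact max_zero_sub_max_neg_zero_eq_self (u x)
  have hdensities := (withDensity_eq_iff hu.1.aemeasurable.ennreal_ofReal
    hneg.1.aemeasurable.ennreal_ofReal hu.lintegral_lt_top.ne).1 hparts
  filter_upwards [hdensities] with x hx
  have hx' := congrArg ENNReal.toReal hx
  simp only [ENNReal.toReal_ofReal'] at hx'
  rw [← max_zero_sub_max_neg_zero_eq_self (u x), hx', sub_self, Pi.zero_apply]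

theorem ae_eq_zero_of_integral_exp_mul {u : Hat E → ℂ} (hu : Integrable u μ)
    (h : ∀ f : StrongDual ℝ E, ∫ x : Hat E, Complex.exp (x f * Complex.I) * u x ∂μ = 0) :
    u =ᵐ[μ] 0 := by
  have hconj (f : StrongDual ℝ E) :
      ∫ x : Hat E, Complex.exp (x f * Complex.I) * (starRingEnd ℂ) (u x) ∂μ = 0 := by
    rw [← map_zero (starRingEnd ℂ), ← h (-f), ← integral_conj]
    congr with x
    simp [← Complex.exp_conj]
  have hu' : Integrable (fun x => (starRingEnd ℂ) (u x)) μ :=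
    (LinearIsometryEquiv.integrable_comp_iff Complex.conjLIE).2 hu
  -- real and imaginary parts are combinations of `u` and its conjugate
  have hcomb (a b : ℂ) (f : StrongDual ℝ E) : ∫ x : Hat E, Complex.exp (x f * Complex.I)
      * (a * u x + b * (starRingEnd ℂ) (u x)) ∂μ = 0 := by
    simp only [mul_add, mul_left_comm _ a, mul_left_comm _ b]
    rw [integral_add ((integrable_exp_eval_mul_I_mul hu f).const_mul a)
      ((integrable_exp_eval_mul_I_mul hu' f).const_mul b), integral_const_mul,
      integral_const_mul, h, hconj, mul_zero, mul_zero, add_zero]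
  have hre : (fun x => (u x).re) =ᵐ[μ] 0 :=
    ae_eq_zero_of_integral_exp_mul_ofReal hu.re fun f => by
      simpa only [Complex.re_eq_add_conj, add_div, div_eq_inv_mul, mul_add] using hcomb 2⁻¹ 2⁻¹ f
  have him : (fun x => (u x).im) =ᵐ[μ] 0 :=
    ae_eq_zero_of_integral_exp_mul_ofReal hu.im fun f => by
      simpa only [Complex.im_eq_sub_conj, sub_div, div_eq_inv_mul, mul_add, mul_sub, neg_mul,
        mul_neg, ← sub_eq_add_neg] using hcomb (2 * Complex.I)⁻¹ (-(2 * Complex.I)⁻¹) f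
  filter_upwards [hre, him] with x hx_re hx_im
  exact Complex.ext hx_re hx_im

end fourier

/-! ### Gaussian measures on `Hat E` -/

namespace IsHatGaussian

variable {E : Type*} [SeminormedAddCommGroup E] [NormedSpace ℝ E] {ν : Measure (Hat E)} {v : ℝ≥0}

theorem isProbabilityMeasure (hν : IsHatGaussian ν v) : IsProbabilityMeasure ν := by
  constructor
  have h := Measure.map_apply (μ := ν) (measurable_eval (0 : StrongDual ℝ E)) MeasurableSet.univ
  rw [hν, measure_univ] at h
  exact h.symm

theorem integrable_exp (hν : IsHatGaussian ν v) (f : StrongDual ℝ E) :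
    Integrable (fun x : Hat E => Real.exp (x f)) ν := by
  have h : Integrable (fun y : ℝ => Real.exp (1 * y)) (ν.map fun x : Hat E => x f) := by
    rw [hν]
    exact integrable_exp_mul_gaussianReal 1
  simpa [Function.comp_def] using h.comp_measurable (measurable_eval f)

theorem integral_exp (hν : IsHatGaussian ν v) (f : StrongDual ℝ E) :
    ∫ x : Hat E, Real.exp (x f) ∂ν = Real.exp (v / 2 * ‖f‖ ^ 2) := by
  have h := mgf_gaussianReal (hν f) 1
  simp only [mgf, one_mul] at h
  rw [h]
  congr 1
  push_cast
  ring

theorem measurePreserving_hatMap {E' : Type*} [SeminormedAddCommGroup E'] [NormedSpace ℝ E']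
    {ν' : Measure (Hat E')} (hν : IsHatGaussian ν v) (hν' : IsHatGaussian ν' v) {A : E →L[ℝ] E'}
    (hA : ∀ f : StrongDual ℝ E', ‖f.comp A‖ = ‖f‖) : MeasurePreserving (hatMap A) ν ν' := by
  have := hν.isProbabilityMeasure
  have := hν'.isProbabilityMeasure
  refine ⟨measurable_hatMap A, measure_hat_ext_of_map_eval fun f => ?_⟩
  have hnorm : ‖f.comp A‖₊ = ‖f‖₊ := NNReal.eq (hA f)
  rw [Measure.map_map (measurable_eval f) (measurable_hatMap A), hν', ← hnorm, ← hν]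
  rfl

section tilted
variable {H : Type*} [NormedAddCommGroup H] [InnerProductSpace ℝ H]

theorem mgf_tilted (hν : IsHatGaussian ν v) (A : StrongDual ℝ E →ₗᵢ[ℝ] H)
    (a b : StrongDual ℝ E) :
    mgf (fun x : Hat E => x b) (ν.tilted fun x : Hat E => x a)
      = mgf id (gaussianReal (v * ⟪A a, A b⟫_ℝ) (v * ‖b‖₊ ^ 2)) := by
  funext t
  have hexp : (fun x : Hat E => Real.exp (((fun x : Hat E => x a) + fun x : Hat E => t * x b) x))
      = fun x => Real.exp (x (a + t • b)) := by
    funext x; simp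
  rw [mgf_id_gaussianReal, mgf, integral_exp_tilted, hν.integral_exp, hexp, hν.integral_exp,
    ← Real.exp_sub]
  congr 1
  have hnorm := norm_add_sq_real (A a) (A (t • b))
  rw [← map_add, A.norm_map, A.norm_map, A.norm_map, norm_smul, map_smul, inner_smul_right,
    mul_pow, Real.norm_eq_abs, sq_abs] at hnorm
  rw [hnorm]
  push_cast
  ring

theorem map_tilted (hν : IsHatGaussian ν v) (A : StrongDual ℝ E →ₗᵢ[ℝ] H)
    (a b : StrongDual ℝ E) :
    (ν.tilted fun x : Hat E => x a).map (fun x : Hat E => x b)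
      = gaussianReal (v * ⟪A a, A b⟫_ℝ) (v * ‖b‖₊ ^ 2) := by
  have := hν.isProbabilityMeasure
  have := isProbabilityMeasure_tilted (hν.integrable_exp a)
  have hset : integrableExpSet (fun x : Hat E => x b) (ν.tilted fun x : Hat E => x a)
      = Set.univ := by
    refine Set.eq_univ_of_forall fun t => ?_
    rw [integrableExpSet, Set.mem_ofPred_eq, integrable_tilted_iff (hν.integrable_exp a)]
    refine (hν.integrable_exp (a + t • b)).congr (ae_of_all _ fun x => ?_)
    simp [Real.exp_add]
  have hcomplex : complexMGF (fun x : Hat E => x b) (ν.tilted fun x : Hat E => x a)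
      = complexMGF id (gaussianReal (v * ⟪A a, A b⟫_ℝ) (v * ‖b‖₊ ^ 2)) :=
    funext fun z => eqOn_complexMGF_of_mgf (hν.mgf_tilted A a b) (by simp [hset])
  simpa only [Measure.map_id] using
    Measure.ext_of_complexMGF_eq (measurable_eval b).aemeasurable aemeasurable_id hcomplex

theorem integral_exp_add_mul_I (hν : IsHatGaussian ν v) (A : StrongDual ℝ E →ₗᵢ[ℝ] H)
    (a b : StrongDual ℝ E) :
    ∫ x : Hat E, Complex.exp ((x a : ℂ) + x b * Complex.I) ∂ν
      = Complex.exp (v / 2 * ((‖A a‖ ^ 2 - ‖A b‖ ^ 2 : ℝ) + 2 * ⟪A a, A b⟫_ℝ * Complex.I)) := by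
  have hchar : charFun ((ν.tilted fun x : Hat E => x a).map (fun x : Hat E => x b)) 1
      = ∫ x : Hat E, Complex.exp (x b * Complex.I) ∂(ν.tilted fun x : Hat E => x a) := by
    rw [charFun_apply_real, integral_map (measurable_eval b).aemeasurable (by fun_prop)]
    simp
  rw [hν.map_tilted A, charFun_gaussianReal, integral_tilted, hν.integral_exp] at hchar
  have hexp (x : Hat E) : Complex.exp ((x a : ℂ) + x b * Complex.I)
      = (Real.exp (v / 2 * ‖a‖ ^ 2) : ℂ) *
        ((Real.exp (x a) / Real.exp (v / 2 * ‖a‖ ^ 2)) • Complex.exp (x b * Complex.I)) := by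
    rw [Complex.exp_add, Complex.real_smul]
    push_cast
    field_simp
  simp_rw [hexp]
  rw [integral_const_mul, ← hchar, Complex.ofReal_exp, ← Complex.exp_add, A.norm_map, A.norm_map]
  congr 1
  push_cast
  ring

theorem tilted_eq_map_add (hν : IsHatGaussian ν v) (A : StrongDual ℝ E →ₗᵢ[ℝ] H)
    (a : StrongDual ℝ E) (y : Hat E) (hy : ∀ b, y b = v * ⟪A a, A b⟫_ℝ) :
    (ν.tilted fun x : Hat E => x a) = ν.map fun x => x + y := by
  have := hν.isProbabilityMeasure
  have := isProbabilityMeasure_tilted (hν.integrable_exp a)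
  refine measure_hat_ext_of_map_eval fun b => ?_
  have hcomp : ((fun x : Hat E => x b) ∘ fun x => x + y)
      = (fun t : ℝ => t + y b) ∘ fun x : Hat E => x b := by
    funext x; simp
  rw [hν.map_tilted A, Measure.map_map (measurable_eval b) (measurable_add_right_hat y), hcomp,
    ← Measure.map_map (measurable_add_const _) (measurable_eval b), hν,
    gaussianReal_map_add_const, zero_add, hy]

theorem integral_add (hν : IsHatGaussian ν v) (A : StrongDual ℝ E →ₗᵢ[ℝ] H)
    (a : StrongDual ℝ E) (y : Hat E) (hy : ∀ b, y b = v * ⟪A a, A b⟫_ℝ) {G : Hat E → ℂ}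
    (hG : Measurable G) :
    ∫ x, G (x + y) ∂ν = ∫ x : Hat E, Complex.exp (x a - v / 2 * ‖a‖ ^ 2) * G x ∂ν := by
  rw [← integral_map (f := G) (measurable_add_right_hat y).aemeasurable hG.aestronglyMeasurable,
    ← hν.tilted_eq_map_add A a y hy, integral_tilted, hν.integral_exp]
  congr with x
  rw [Complex.real_smul, Complex.exp_sub]
  push_cast
  rfl

theorem integrable_add (hν : IsHatGaussian ν v) (A : StrongDual ℝ E →ₗᵢ[ℝ] H)
    (a : StrongDual ℝ E) (y : Hat E) (hy : ∀ b, y b = v * ⟪A a, A b⟫_ℝ) {G : Hat E → ℂ}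
    (hG : Measurable G) (hi : Integrable (fun x : Hat E => Complex.exp (x a) * G x) ν) :
    Integrable (fun x => G (x + y)) ν := by
  refine (integrable_map_measure (f := fun x => x + y) hG.aestronglyMeasurable
    (measurable_add_right_hat y).aemeasurable).1 ?_
  rw [← hν.tilted_eq_map_add A a y hy, integrable_tilted_iff (hν.integrable_exp a)]
  exact hi.congr (ae_of_all _ fun x => by simp)

end tilted

end IsHatGaussian

/-! ### The mean value property -/

section meanValue
variable {X F : Type*} [MeasurableSpace X] {μ : Measure X} [SFinite μ] [NormedAddCommGroup F]
  {r : ℂ → X → X} {ψ : X → F}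

theorem integrable_uncurry_comp_circleMap (hr : Measurable (Function.uncurry r))
    (hμ : ∀ z, ‖z‖ = 1 → MeasurePreserving (r z) μ μ)
    (hm : StronglyMeasurable ψ) (hi : Integrable ψ μ) :
    Integrable (Function.uncurry fun (θ : ℝ) x => ψ (r (circleMap 0 1 θ) x))
      ((volume.restrict (Set.Ioc 0 (2 * Real.pi))).prod μ) := by
  have hrot (θ : ℝ) : MeasurePreserving (r (circleMap 0 1 θ)) μ μ := hμ _ (by simp)
  have hmeas : StronglyMeasurable
      (Function.uncurry fun (θ : ℝ) x => ψ (r (circleMap 0 1 θ) x)) :=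
    hm.comp_measurable (hr.comp
      (((continuous_circleMap 0 1).measurable.comp measurable_fst).prodMk measurable_snd))
  refine (integrable_prod_iff hmeas.aestronglyMeasurable).2
    ⟨ae_of_all _ fun θ => (hrot θ).integrable_comp_of_integrable hi, ?_⟩
  have hnorm (θ : ℝ) : ∫ x, ‖ψ (r (circleMap 0 1 θ) x)‖ ∂μ = ∫ x, ‖ψ x‖ ∂μ := by
    rw [← integral_map (f := fun x => ‖ψ x‖) (hrot θ).aemeasurable hm.norm.aestronglyMeasurable,
      (hrot θ).map_eq]
  simp only [Function.uncurry_apply_pair, hnorm]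
  exact integrable_const _

/-- Averaging over the circle action leaves the integral unchanged, and replaces `ψ` by its value
at the centre of each orbit disc. -/
theorem integral_eq_integral_comp_zero [NormedSpace ℂ F] [CompleteSpace F]
    (hr : Measurable (Function.uncurry r)) (hμ : ∀ z, ‖z‖ = 1 → MeasurePreserving (r z) μ μ)
    (hm : StronglyMeasurable ψ) (hi : Integrable ψ μ)
    (hd : ∀ x, DiffContOnCl ℂ (fun z => ψ (r z x)) (Metric.ball 0 1)) :
    ∫ x, ψ x ∂μ = ∫ x, ψ (r 0 x) ∂μ := by
  have hpi : 0 < 2 * Real.pi := by positivity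
  have hrot (θ : ℝ) : ∫ x, ψ (r (circleMap 0 1 θ) x) ∂μ = ∫ x, ψ x ∂μ := by
    have hθ := hμ (circleMap 0 1 θ) (by simp)
    rw [← integral_map hθ.aemeasurable hm.aestronglyMeasurable, hθ.map_eq]
  have hmean (x : X) : ∫ θ in Set.Ioc 0 (2 * Real.pi), ψ (r (circleMap 0 1 θ) x)
      = (2 * Real.pi) • ψ (r 0 x) := by
    have haverage : Real.circleAverage (fun z => ψ (r z x)) 0 1 = ψ (r 0 x) :=
      DiffContOnCl.circleAverage (by simpa using hd x)
    rw [← haverage, Real.circleAverage, smul_inv_smul₀ hpi.ne',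
      intervalIntegral.integral_of_le hpi.le]
  have hswap := integral_integral_swap (integrable_uncurry_comp_circleMap hr hμ hm hi)
  simp only [hrot, hmean] at hswap
  rw [setIntegral_const, integral_smul, Real.volume_real_Ioc_of_le hpi.le, sub_zero] at hswap
  exact smul_right_injective F hpi.ne' hswap

end meanValue

/-! ### The complex structure -/

namespace FieldTheory

variable {L : Type*} [NormedAddCommGroup L] [InnerProductSpace ℝ L] (T : FieldTheory L)

theorem inner_J_J (τ ξ : L) : ⟪T.J τ, T.J ξ⟫_ℝ = ⟪τ, ξ⟫_ℝ := by
  rw [inner_eq_omega, omega_J_J, inner_eq_omega]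

theorem inner_J_left (τ ξ : L) : ⟪T.J τ, ξ⟫_ℝ = 2 * T.omega τ ξ := by
  rw [inner_eq_omega, omega_J_J]

theorem omega_self (τ : L) : T.omega τ τ = 0 :=
  self_eq_neg.1 (T.omega_swap τ τ)

/-- The complex structure `J` as a linear isometry. -/
def JIsom : L →ₗᵢ[ℝ] L := T.J.isometryOfInner T.inner_J_J

theorem herm_eq_inner (τ ξ : L) :
    T.herm τ ξ = (⟪τ, ξ⟫_ℝ : ℂ) + ⟪T.J τ, ξ⟫_ℝ * Complex.I := by
  rw [herm_apply, inner_J_left]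
  push_cast
  ring

theorem ext_herm (τ : L) (x : Hat L) :
    ext (T.herm τ) x = (x (innerSL ℝ τ) : ℂ) + x (innerSL ℝ (T.J τ)) * Complex.I := by
  have hre : Complex.reCLM.comp (T.herm τ) = innerSL ℝ τ := by
    ext ξ; simp [herm_eq_inner]
  have him : Complex.imCLM.comp (T.herm τ) = innerSL ℝ (T.J τ) := by
    ext ξ; simp [herm_eq_inner]
  rw [ext, hre, him]

theorem herm_self (τ : L) : T.herm τ τ = (‖τ‖ ^ 2 : ℝ) := by
  rw [herm_apply, omega_self, real_inner_self_eq_norm_sq]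
  simp

theorem herm_conj_symm (τ ξ : L) : (starRingEnd ℂ) (T.herm ξ τ) = T.herm τ ξ := by
  rw [herm_apply, herm_apply, T.omega_swap ξ τ, real_inner_comm]
  simp [Complex.conj_ofNat]

theorem herm_add_left (τ τ' : L) : T.herm (τ + τ') = T.herm τ + T.herm τ' := by
  ext ξ
  rw [add_apply, ← herm_conj_symm, map_add, map_add, herm_conj_symm, herm_conj_symm]

/-- Multiplication by complex numbers on `(L, J)`. -/
def cmul (z : ℂ) : L →L[ℝ] L :=
  z.re • ContinuousLinearMap.id ℝ L + z.im • T.JIsom.toContinuousLinearMap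

theorem cmul_apply (z : ℂ) (ξ : L) : T.cmul z ξ = z.re • ξ + z.im • T.J ξ := rfl

theorem cmul_zero : T.cmul 0 = 0 := by
  ext ξ; simp [cmul_apply]

theorem cmul_one : T.cmul 1 = ContinuousLinearMap.id ℝ L := by
  ext ξ; simp [cmul_apply]

theorem cmul_add (z w : ℂ) : T.cmul (z + w) = T.cmul z + T.cmul w := by
  ext ξ
  simp only [cmul_apply, add_apply, Complex.add_re, Complex.add_im]
  module

theorem cmul_mul (z w : ℂ) : T.cmul (z * w) = (T.cmul z).comp (T.cmul w) := by
  ext ξ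
  simp only [cmul_apply, ContinuousLinearMap.comp_apply, map_add, map_smul, T.J_sq,
    Complex.mul_re, Complex.mul_im]
  module

theorem comp_cmul {l : L →L[ℝ] ℂ} (hl : ∀ ξ, l (T.J ξ) = Complex.I * l ξ) (z : ℂ) :
    l.comp (T.cmul z) = z • l := by
  ext ξ
  simp only [ContinuousLinearMap.comp_apply, cmul_apply, map_add, map_smul, hl,
    Complex.real_smul, FunLike.coe_smul, Pi.smul_apply, smul_eq_mul]
  nth_rw 3 [← Complex.re_add_im z]
  ring

theorem herm_cmul_right (τ : L) (z : ℂ) (ξ : L) : T.herm τ (T.cmul z ξ) = z * T.herm τ ξ :=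
  DFunLike.congr_fun (T.comp_cmul (T.herm_J τ) z) ξ

theorem herm_cmul_left (z : ℂ) (τ : L) :
    T.herm (T.cmul z τ) = (starRingEnd ℂ) z • T.herm τ := by
  ext ξ
  rw [← herm_conj_symm, herm_cmul_right, map_mul, herm_conj_symm]
  rfl

theorem norm_cmul (z : ℂ) (ξ : L) : ‖T.cmul z ξ‖ = ‖z‖ * ‖ξ‖ := by
  have h := T.herm_self (T.cmul z ξ)
  rw [herm_cmul_left, FunLike.coe_smul, Pi.smul_apply, herm_cmul_right, herm_self, smul_eq_mul,
    ← mul_assoc, mul_comm _ z, Complex.mul_conj, Complex.normSq_eq_norm_sq, ← Complex.ofReal_mul,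
    Complex.ofReal_inj, ← mul_pow] at h
  exact (pow_left_inj₀ (by positivity) (by positivity) two_ne_zero).1 h.symm

theorem norm_comp_cmul_le {z : ℂ} (hz : ‖z‖ = 1) (f : StrongDual ℝ L) :
    ‖f.comp (T.cmul z)‖ ≤ ‖f‖ :=
  ContinuousLinearMap.opNorm_le_bound _ (norm_nonneg f) fun ξ => by
    simpa [norm_cmul, hz] using f.le_opNorm (T.cmul z ξ)

theorem norm_comp_cmul {z : ℂ} (hz : ‖z‖ = 1) (f : StrongDual ℝ L) :
    ‖f.comp (T.cmul z)‖ = ‖f‖ := by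
  refine (T.norm_comp_cmul_le hz f).antisymm ?_
  have hinv : f = (f.comp (T.cmul z)).comp (T.cmul z⁻¹) := by
    rw [ContinuousLinearMap.comp_assoc, ← cmul_mul, mul_inv_cancel₀ (by simp [← norm_pos_iff, hz]),
      cmul_one, ContinuousLinearMap.comp_id]
  conv_lhs => rw [hinv]
  exact T.norm_comp_cmul_le (by simp [hz]) _

theorem ext_hatMap_cmul {l : L →L[ℝ] ℂ} (hl : ∀ ξ, l (T.J ξ) = Complex.I * l ξ) (z : ℂ)
    (x : Hat L) : ext l (hatMap (T.cmul z) x) = z * ext l x := by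
  rw [ext_hatMap, T.comp_cmul hl, ext_smul]

theorem measurable_hatMap_cmul : Measurable fun p : ℂ × Hat L => hatMap (T.cmul p.1) p.2 :=
  measurable_toHat fun f => by
    simp only [hatMap_apply, cmul, ContinuousLinearMap.comp_add, ContinuousLinearMap.comp_smul,
      map_add, map_smul, smul_eq_mul]
    exact ((Complex.measurable_re.comp measurable_fst).mul
      ((measurable_eval _).comp measurable_snd)).add
      ((Complex.measurable_im.comp measurable_fst).mul ((measurable_eval _).comp measurable_snd))

theorem hatMap_cmul_zero (x : Hat L) : hatMap (T.cmul 0) x = 0 := by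
  ext f
  simp [hatMap_apply, cmul_zero]

theorem integral_eq_of_differentiable {ν : Measure (Hat L)} {v : ℝ≥0} (hν : IsHatGaussian ν v)
    {ψ : Hat L → ℂ} (hm : Measurable ψ) (hi : Integrable ψ ν)
    (hd : ∀ x, Differentiable ℂ fun z : ℂ => ψ (hatMap (T.cmul z) x)) :
    ∫ x, ψ x ∂ν = ψ 0 := by
  have := hν.isProbabilityMeasure
  rw [integral_eq_integral_comp_zero T.measurable_hatMap_cmul
    (fun z hz => hν.measurePreserving_hatMap hν (T.norm_comp_cmul hz)) hm.stronglyMeasurable hi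
    fun x => (hd x).diffContOnCl]
  simp [hatMap_cmul_zero]

/-- `L` with its complex structure `J` as a complex vector space. -/
abbrev complexModule : Module ℂ L where
  smul z ξ := T.cmul z ξ
  one_smul ξ := DFunLike.congr_fun T.cmul_one ξ
  mul_smul z w ξ := DFunLike.congr_fun (T.cmul_mul z w) ξ
  smul_zero z := map_zero (T.cmul z)
  smul_add z := map_add (T.cmul z)
  add_smul z w ξ := DFunLike.congr_fun (T.cmul_add z w) ξ
  zero_smul ξ := DFunLike.congr_fun T.cmul_zero ξ

/-- `L` with its complex structure `J` as a complex normed space. -/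
abbrev complexNormedSpace : NormedSpace ℂ L where
  __ := T.complexModule
  norm_smul_le z ξ := (T.norm_cmul z ξ).le

/-- `L` with its complex structure `J` and the form `{·,·}` as a complex inner product space. -/
abbrev complexInnerProductSpace : InnerProductSpace ℂ L where
  __ := T.complexNormedSpace
  inner τ ξ := T.herm τ ξ
  norm_sq_eq_re_inner ξ := by rw [herm_self]; exact (Complex.ofReal_re _).symm
  conj_inner_symm τ ξ := T.herm_conj_symm τ ξ
  add_left τ τ' ξ := DFunLike.congr_fun (T.herm_add_left τ τ') ξ
  smul_left τ ξ z := DFunLike.congr_fun (T.herm_cmul_left z τ) ξ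

theorem exists_herm_eq [CompleteSpace L] {l : L →L[ℝ] ℂ}
    (hl : ∀ ξ, l (T.J ξ) = Complex.I * l ξ) : ∃ τ, T.herm τ = l := by
  let := T.complexInnerProductSpace
  let lc : StrongDual ℂ L :=
    { toFun := l
      map_add' := map_add l
      map_smul' := fun z ξ => DFunLike.congr_fun (T.comp_cmul hl z) ξ
      cont := l.continuous }
  exact ⟨(InnerProductSpace.toDual ℂ L).symm lc, ContinuousLinearMap.ext fun ξ =>
    InnerProductSpace.toDual_symm_apply (𝕜 := ℂ) (x := ξ) (y := lc)⟩

/-- Orthonormality with respect to the hermitian form `{·,·}`. -/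
def IsHermOrthonormal {κ : Type*} [DecidableEq κ] (e : κ → L) : Prop :=
  ∀ j k, T.herm (e j) (e k) = if j = k then 1 else 0

theorem exists_isHermOrthonormal_expansion {ι : Type*} [Finite ι] (t : ι → L) :
    ∃ (m : ℕ) (e : Fin m → L), T.IsHermOrthonormal e ∧
      ∀ i, T.herm (t i) = ∑ k, T.herm (t i) (e k) • T.herm (e k) := by
  let := T.complexInnerProductSpace
  let V : Submodule ℂ L := Submodule.span ℂ (Set.range t)
  have : FiniteDimensional ℂ V := FiniteDimensional.span_of_finite ℂ (Set.finite_range t)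
  let b := stdOrthonormalBasis ℂ V
  refine ⟨Module.finrank ℂ V, fun k => b k, orthonormal_iff_ite.1 b.orthonormal, fun i => ?_⟩
  ext ξ
  have ht : t i = ∑ k, ⟪(b k : L), t i⟫_ℂ • (b k : L) := by
    simpa using congrArg Subtype.val
      (b.sum_repr' ⟨t i, Submodule.subset_span ⟨i, rfl⟩⟩).symm
  calc ⟪t i, ξ⟫_ℂ = ∑ k, ⟪t i, b k⟫_ℂ * ⟪(b k : L), ξ⟫_ℂ := by
        conv_lhs => rw [ht]
        simp only [sum_inner, inner_smul_left, inner_conj_symm]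
    _ = _ := by
        rw [sum_apply]
        rfl

end FieldTheory

/-! ### Closed spans of families of vectors -/

section closedSpan
variable {V : Type*} [NormedAddCommGroup V] [InnerProductSpace ℂ V]

theorem differentiable_inner_of_mem_closure {k : ℂ → V} {s : Set V}
    (hk : ∀ R, ∃ C, ∀ z, ‖z‖ ≤ R → ‖k z‖ ≤ C)
    (hs : ∀ w ∈ s, Differentiable ℂ fun z => ⟪k z, w⟫_ℂ) {w : V} (hw : w ∈ closure s) :
    Differentiable ℂ fun z => ⟪k z, w⟫_ℂ := by
  obtain ⟨v, hv, hlim⟩ := mem_closure_iff_seq_limit.1 hw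
  have hunif : TendstoLocallyUniformly (fun n z => ⟪k z, v n⟫_ℂ) (fun z => ⟪k z, w⟫_ℂ) atTop := by
    refine tendstoLocallyUniformly_iff_forall_isCompact.2 fun K hK => ?_
    obtain ⟨R, hR⟩ := hK.isBounded.exists_norm_le
    obtain ⟨C, hC⟩ := hk R
    have hlim0 : Tendsto (fun n => C * ‖v n - w‖) atTop (𝓝 0) := by
      simpa using (tendsto_iff_norm_sub_tendsto_zero.1 hlim).const_mul C
    refine Metric.tendstoUniformlyOn_iff.2 fun ε hε => ?_
    filter_upwards [hlim0.eventually (gt_mem_nhds hε)] with n hn z hz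
    rw [dist_comm, dist_eq_norm, ← inner_sub_right]
    calc ‖⟪k z, v n - w⟫_ℂ‖ ≤ ‖k z‖ * ‖v n - w‖ := norm_inner_le_norm _ _
      _ ≤ C * ‖v n - w‖ := by gcongr; exact hC z (hR z hz)
      _ < ε := hn
  exact differentiableOn_univ.1 ((tendstoLocallyUniformlyOn_univ.2 hunif).differentiableOn
    (Eventually.of_forall fun n => (hs _ (hv n)).differentiableOn) isOpen_univ)

theorem differentiable_inner_of_mem_closure_span {k : ℂ → V} {s : Set V}
    (hk : ∀ R, ∃ C, ∀ z, ‖z‖ ≤ R → ‖k z‖ ≤ C)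
    (hs : ∀ w ∈ s, Differentiable ℂ fun z => ⟪k z, w⟫_ℂ) {w : V}
    (hw : w ∈ (Submodule.span ℂ s).topologicalClosure) :
    Differentiable ℂ fun z => ⟪k z, w⟫_ℂ := by
  refine differentiable_inner_of_mem_closure hk (fun w hw => ?_) hw
  induction hw using Submodule.span_induction with
  | mem w hw => exact hs w hw
  | zero => simp
  | add v w _ _ hv hw => simp only [inner_add_right]; exact hv.add hw
  | smul c w _ hw => simp only [inner_smul_right]; exact hw.const_mul c

/-- The vector `w` of `L²(μ)` is represented by the measurable function `x ↦ ⟪k x, w⟫`. -/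
def IsReproduced {X : Type*} [MeasurableSpace X] {μ : Measure X} (k : X → Lp ℂ 2 μ)
    (w : Lp ℂ 2 μ) : Prop :=
  (Measurable fun x => ⟪k x, w⟫_ℂ) ∧ w =ᵐ[μ] fun x => ⟪k x, w⟫_ℂ

theorem isReproduced_of_mem_closure {X : Type*} [MeasurableSpace X] {μ : Measure X}
    {k : X → Lp ℂ 2 μ} {s : Set (Lp ℂ 2 μ)} (hs : ∀ w ∈ s, IsReproduced k w) {w : Lp ℂ 2 μ}
    (hw : w ∈ closure s) : IsReproduced k w := by
  obtain ⟨v, hv, hlim⟩ := mem_closure_iff_seq_limit.1 hw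
  have hpointwise (x : X) : Tendsto (fun n => ⟪k x, v n⟫_ℂ) atTop (𝓝 ⟪k x, w⟫_ℂ) :=
    tendsto_const_nhds.inner hlim
  refine ⟨measurable_of_tendsto_metrizable (fun n => (hs _ (hv n)).1)
    (tendsto_pi_nhds.2 hpointwise), ?_⟩
  obtain ⟨φ, hφ, hae⟩ := (tendstoInMeasure_of_tendsto_Lp hlim).exists_seq_tendsto_ae
  filter_upwards [hae, ae_all_iff.2 fun n => (hs _ (hv n)).2] with x hx hrepr
  simp only [hrepr] at hx
  exact tendsto_nhds_unique hx ((hpointwise x).comp hφ.tendsto_atTop)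

theorem isReproduced_of_mem_closure_span {X : Type*} [MeasurableSpace X] {μ : Measure X}
    {k : X → Lp ℂ 2 μ} {s : Set (Lp ℂ 2 μ)} (hs : ∀ w ∈ s, IsReproduced k w) {w : Lp ℂ 2 μ}
    (hw : w ∈ (Submodule.span ℂ s).topologicalClosure) : IsReproduced k w := by
  refine isReproduced_of_mem_closure (fun w hw => ?_) hw
  induction hw using Submodule.span_induction with
  | mem w hw => exact hs w hw
  | zero =>
    simp only [IsReproduced, inner_zero_right]
    exact ⟨measurable_const, Lp.coeFn_zero ℂ 2 μ⟩
  | add v w _ _ hv hw =>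
    simp only [IsReproduced, inner_add_right]
    exact ⟨hv.1.add hw.1, (Lp.coeFn_add v w).trans (hv.2.add hw.2)⟩
  | smul c w _ hw =>
    simp only [IsReproduced, inner_smul_right]
    exact ⟨hw.1.const_mul c, (Lp.coeFn_smul c w).trans (hw.2.const_smul c)⟩

end closedSpan

/-! ### The holomorphic representation -/

namespace FieldTheory

variable {L : Type*} [NormedAddCommGroup L] [InnerProductSpace ℝ L] (T : FieldTheory L)

theorem conj_exp_half_herm (τ : L) (x : Hat L) :
    (starRingEnd ℂ) (Complex.exp (1 / 2 * ext (T.herm τ) x))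
      = Complex.exp (x (innerSL ℝ τ)) * Complex.exp (-(1 / 2 * ext (T.herm τ) x)) := by
  rw [← Complex.exp_add, ← Complex.exp_conj, ext_herm]
  congr 1
  simp [Complex.conj_ofNat]
  ring

theorem measurable_exp_ext_herm (c : ℂ) (τ : L) :
    Measurable fun x : Hat L => Complex.exp (c * ext (T.herm τ) x) :=
  Complex.measurable_exp.comp ((measurable_ext _).const_mul c)

/-- Translating by `τ` turns the left-hand side into the integral of a holomorphic function, which
the mean value property evaluates. -/
theorem integral_conj_exp_half_herm_mul [CompleteSpace L] {ν : Measure (Hat L)}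
    (hν : IsHatGaussian ν 1) (τ : L) {ψ : Hat L → ℂ} (hm : Measurable ψ)
    (hi : Integrable
      (fun x => (starRingEnd ℂ) (Complex.exp (1 / 2 * ext (T.herm τ) x)) * ψ x) ν)
    (hd : ∀ x, Differentiable ℂ fun z : ℂ => ψ (hatMap (T.cmul z) x + incl τ)) :
    ∫ x, (starRingEnd ℂ) (Complex.exp (1 / 2 * ext (T.herm τ) x)) * ψ x ∂ν = ψ (incl τ) := by
  let A := (InnerProductSpace.toDual ℝ L).symm.toLinearIsometry
  have hA (b : StrongDual ℝ L) :
      (incl τ : Hat L) b = (1 : ℝ≥0) * ⟪A (innerSL ℝ τ), A b⟫_ℝ := by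
    have hτ : A (innerSL ℝ τ) = τ := (InnerProductSpace.toDual ℝ L).symm_apply_apply τ
    rw [hτ, real_inner_comm, incl_apply]
    simp [A]
  let G : Hat L → ℂ := fun x => Complex.exp (-(1 / 2) * ext (T.herm τ) x) * ψ x
  have hG : Measurable G := (T.measurable_exp_ext_herm _ τ).mul hm
  have hweight (x : Hat L) : Complex.exp (x (innerSL ℝ τ)) * G x
      = (starRingEnd ℂ) (Complex.exp (1 / 2 * ext (T.herm τ) x)) * ψ x := by
    simp only [G, conj_exp_half_herm, neg_mul, mul_assoc]
  have hdiff (x : Hat L) : Differentiable ℂ fun z : ℂ => G (hatMap (T.cmul z) x + incl τ) := by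
    simp only [G, ext_add_right, T.ext_hatMap_cmul (T.herm_J τ)]
    exact Differentiable.mul (by fun_prop) (hd x)
  have hmean := T.integral_eq_of_differentiable hν
    (hG.comp (measurable_add_right_hat (incl τ)))
    (hν.integrable_add A (innerSL ℝ τ) (incl τ) hA hG (by simpa only [hweight] using hi)) hdiff
  simp only [Function.comp_apply, zero_add] at hmean
  rw [hν.integral_add A (innerSL ℝ τ) (incl τ) hA hG] at hmean
  simp only [Complex.exp_sub, div_mul_eq_mul_div _ _ (G _), hweight, integral_div,
    innerSL_apply_norm] at hmean
  rw [div_eq_iff (Complex.exp_ne_zero _)] at hmean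
  rw [hmean, mul_right_comm, ext_incl, herm_self, ← Complex.exp_add]
  simp

section hatProj
variable {κ : Type*} [Fintype κ]

/-- The complex-linear map `x ↦ ∑ₖ {eₖ, x} eₖ` from `Hat L` to `L`.  If `e` is orthonormal with
respect to `{·,·}`, this is the extension to `Hat L` of the projection of `L` to the complex span
of `e`. -/
def hatProj (e : κ → L) (x : Hat L) : L :=
  ∑ k, T.cmul (ext (T.herm (e k)) x) (e k)

theorem hatProj_hatMap_cmul_add (e : κ → L) (z : ℂ) (x y : Hat L) :
    T.hatProj e (hatMap (T.cmul z) x + y) = T.hatProj e y + T.cmul z (T.hatProj e x) := by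
  simp only [hatProj, map_sum, ← Finset.sum_add_distrib, ext_add_right,
    T.ext_hatMap_cmul (T.herm_J _), cmul_add, cmul_mul, add_apply,
    ContinuousLinearMap.comp_apply, add_comm]

theorem herm_hatProj (e : κ → L) (τ : L) (x : Hat L) :
    T.herm τ (T.hatProj e x) = ∑ k, ext (T.herm (e k)) x * T.herm τ (e k) := by
  simp only [hatProj, map_sum, herm_cmul_right]

theorem herm_hatProj_left (e : κ → L) (y : Hat L) : T.herm (T.hatProj e y)
    = ∑ k, (starRingEnd ℂ) (ext (T.herm (e k)) y) • T.herm (e k) := by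
  ext ξ
  rw [← herm_conj_symm, herm_hatProj, map_sum, sum_apply]
  refine Finset.sum_congr rfl fun k _ => ?_
  rw [FunLike.coe_smul, Pi.smul_apply, map_mul, herm_conj_symm, smul_eq_mul]

variable {T} [DecidableEq κ] {e : κ → L}

theorem IsHermOrthonormal.herm_hatProj (he : T.IsHermOrthonormal e) (j : κ) (x : Hat L) :
    T.herm (e j) (T.hatProj e x) = ext (T.herm (e j)) x := by
  simp [T.herm_hatProj, he j]

theorem IsHermOrthonormal.hatProj_incl_hatProj (he : T.IsHermOrthonormal e) (x : Hat L) :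
    T.hatProj e (incl (T.hatProj e x)) = T.hatProj e x := by
  conv_lhs => rw [hatProj]
  simp only [ext_incl, he.herm_hatProj]
  rfl

theorem IsHermOrthonormal.apply_hatProj (he : T.IsHermOrthonormal e) {c : κ → ℂ}
    {l : L →L[ℝ] ℂ} (hl : l = ∑ k, c k • T.herm (e k)) (x : Hat L) :
    l (T.hatProj e x) = ext l x := by
  simp [hl, ext_sum, ext_smul, he.herm_hatProj, sum_apply]

end hatProj

variable [CompleteSpace L]

theorem holCoherentLp_ae_eq (τ : L) :
    T.holCoherentLp τ =ᵐ[T.nuL] fun x => Complex.exp (1 / 2 * ext (T.herm τ) x) := by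
  refine (MemLp.coeFn_toLp _).trans (ae_of_all _ fun x => ?_)
  simp only [ext_smul, add_zero]

theorem inner_holCoherentLp_eq (τ : L) {u : Lp ℂ 2 T.nuL} {ψ : Hat L → ℂ} (hu : u =ᵐ[T.nuL] ψ)
    (hm : Measurable ψ) (hd : ∀ x, Differentiable ℂ fun z => ψ (hatMap (T.cmul z) x + incl τ)) :
    ⟪T.holCoherentLp τ, u⟫_ℂ = ψ (incl τ) := by
  have hinner : (fun x => ⟪T.holCoherentLp τ x, u x⟫_ℂ) =ᵐ[T.nuL]
      fun x => (starRingEnd ℂ) (Complex.exp (1 / 2 * ext (T.herm τ) x)) * ψ x := by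
    filter_upwards [T.holCoherentLp_ae_eq τ, hu] with x hτ hu
    rw [hτ, hu, RCLike.inner_apply, mul_comm]
  rw [L2.inner_def, integral_congr_ae hinner]
  exact T.integral_conj_exp_half_herm_mul T.isHatGaussian_nuL τ hm
    ((L2.integrable_inner _ _).congr hinner) hd

theorem inner_holCoherentLp_holCoherentLp (τ σ : L) :
    ⟪T.holCoherentLp τ, T.holCoherentLp σ⟫_ℂ = T.holCoherent σ τ := by
  rw [T.inner_holCoherentLp_eq τ (T.holCoherentLp_ae_eq σ) (T.measurable_exp_ext_herm _ σ),
    ext_incl, holCoherent]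
  intro x
  simp only [ext_add_right, T.ext_hatMap_cmul (T.herm_J σ)]
  fun_prop

theorem norm_holCoherentLp (τ : L) : ‖T.holCoherentLp τ‖ = Real.exp (1 / 4 * ‖τ‖ ^ 2) := by
  have hsq : ‖T.holCoherentLp τ‖ ^ 2 = Real.exp (1 / 4 * ‖τ‖ ^ 2) ^ 2 := by
    rw [← inner_self_eq_norm_sq (𝕜 := ℂ), inner_holCoherentLp_holCoherentLp, holCoherent,
      herm_self, ← Real.exp_nat_mul, RCLike.re_eq_complex_re,
      show (1 / 2 * ((‖τ‖ ^ 2 : ℝ) : ℂ)) = ((1 / 2 * ‖τ‖ ^ 2 : ℝ) : ℂ) by push_cast; rfl,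
      Complex.exp_ofReal_re]
    congr 1
    push_cast
    ring
  exact (pow_left_inj₀ (by positivity) (by positivity) two_ne_zero).1 hsq

theorem differentiable_inner_holCoherentLp {u : Lp ℂ 2 T.nuL}
    (hu : u ∈ (Submodule.span ℂ (Set.range T.holCoherentLp)).topologicalClosure) (σ τ : L) :
    Differentiable ℂ fun z : ℂ => ⟪T.holCoherentLp (σ + T.cmul z τ), u⟫_ℂ := by
  refine differentiable_inner_of_mem_closure_span
    (fun R => ⟨Real.exp (1 / 4 * (‖σ‖ + R * ‖τ‖) ^ 2), fun z hz => ?_⟩) ?_ hu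
  · have hnorm : ‖σ + T.cmul z τ‖ ≤ ‖σ‖ + R * ‖τ‖ := by
      refine (norm_add_le _ _).trans ?_
      rw [norm_cmul]
      gcongr
    rw [norm_holCoherentLp]
    gcongr
  · rintro _ ⟨ρ, rfl⟩
    simp only [inner_holCoherentLp_holCoherentLp, holCoherent, map_add, herm_cmul_right]
    fun_prop

section totality
variable {T} {κ : Type*} [Fintype κ] [DecidableEq κ] {e : κ → L}

theorem IsHermOrthonormal.isReproduced (he : T.IsHermOrthonormal e) {w : Lp ℂ 2 T.nuL}
    (hw : w ∈ (Submodule.span ℂ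
      (Set.range fun y => T.holCoherentLp (T.hatProj e y))).topologicalClosure) :
    IsReproduced (fun x => T.holCoherentLp (T.hatProj e x)) w := by
  refine isReproduced_of_mem_closure_span ?_ hw
  rintro _ ⟨y, rfl⟩
  simp only [IsReproduced, inner_holCoherentLp_holCoherentLp, holCoherent,
    he.apply_hatProj (T.herm_hatProj_left e y)]
  exact ⟨T.measurable_exp_ext_herm _ _, T.holCoherentLp_ae_eq _⟩

/-- The difference `D` between the cylinder function and its orthogonal projection to the closed
span is a holomorphic function of `hatProj e x`, so the reproducing property makes it vanish. -/
theorem IsHermOrthonormal.mem_closure_span (he : T.IsHermOrthonormal e) {ι : Type*} [Finite ι]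
    {l : ι → L →L[ℝ] ℂ} {c : ι → κ → ℂ} (hl : ∀ i, l i = ∑ k, c i k • T.herm (e k))
    (hlJ : ∀ i ξ, l i (T.J ξ) = Complex.I * l i ξ) {h : (ι → ℂ) → ℂ} (hh : Differentiable ℂ h)
    {u : Lp ℂ 2 T.nuL} (hu : u =ᵐ[T.nuL] fun x => h fun i => ext (l i) x) :
    u ∈ (Submodule.span ℂ (Set.range T.holCoherentLp)).topologicalClosure := by
  cases nonempty_fintype ι
  let W := (Submodule.span ℂ
    (Set.range fun y => T.holCoherentLp (T.hatProj e y))).topologicalClosure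
  have hW : W ≤ (Submodule.span ℂ (Set.range T.holCoherentLp)).topologicalClosure :=
    Submodule.topologicalClosure_mono <| Submodule.span_mono <| by
      rintro _ ⟨y, rfl⟩
      exact ⟨_, rfl⟩
  have : CompleteSpace W := (Submodule.isClosed_topologicalClosure _).completeSpace_coe
  let w : Lp ℂ 2 T.nuL := W.starProjection u
  have hw : w ∈ W := W.starProjection_apply_mem u
  let D : Hat L → ℂ := fun x =>
    (h fun i => ext (l i) x) - ⟪T.holCoherentLp (T.hatProj e x), w⟫_ℂ
  have hmeas : Measurable D := (hh.continuous.measurable.comp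
    (measurable_pi_lambda _ fun i => measurable_ext (l i))).sub (he.isReproduced hw).1
  have hae : (u - w : Lp ℂ 2 T.nuL) =ᵐ[T.nuL] D :=
    (Lp.coeFn_sub u w).trans (hu.sub (he.isReproduced hw).2)
  have hdiff (x y : Hat L) : Differentiable ℂ fun z => D (hatMap (T.cmul z) x + y) := by
    simp only [D, hatProj_hatMap_cmul_add, ext_add_right, T.ext_hatMap_cmul (hlJ _)]
    exact (hh.comp (by fun_prop)).sub (T.differentiable_inner_holCoherentLp (hW hw) _ _)
  have hproj (x : Hat L) : D (incl (T.hatProj e x)) = D x := by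
    simp only [D, ext_incl, he.apply_hatProj (hl _), he.hatProj_incl_hatProj]
  have hzero : D = 0 := funext fun x => by
    rw [← hproj, ← T.inner_holCoherentLp_eq (T.hatProj e x) hae hmeas fun y => hdiff y _]
    exact W.sub_starProjection_mem_orthogonal u _
      (Submodule.le_topologicalClosure _ (Submodule.subset_span ⟨x, rfl⟩))
  have huw : u = w :=
    sub_eq_zero.1 (Lp.ext ((hzero ▸ hae).trans (Lp.coeFn_zero ℂ 2 T.nuL).symm))
  exact huw ▸ hW hw

end totality

theorem HH_le_closure_span :
    T.HH ≤ (Submodule.span ℂ (Set.range T.holCoherentLp)).topologicalClosure := by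
  refine Submodule.topologicalClosure_minimal _ (Submodule.span_le.2 ?_)
    (Submodule.isClosed_topologicalClosure _)
  rintro u ⟨_, ⟨n, l, h, hl, hh, rfl⟩, hu⟩
  choose t ht using fun i => T.exists_herm_eq (hl i)
  obtain ⟨m, e, he, hexp⟩ := T.exists_isHermOrthonormal_expansion t
  exact he.mem_closure_span (fun i => (ht i).symm.trans (hexp i)) hl hh hu

theorem eq_zero_of_inner_holCoherentState {u : T.HH}
    (h : ∀ τ, ⟪T.holCoherentState τ, u⟫_ℂ = 0) : u = 0 := by
  have horth : (Submodule.span ℂ (Set.range T.holCoherentLp)).topologicalClosure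
      ≤ (ℂ ∙ (u : Lp ℂ 2 T.nuL))ᗮ := by
    refine Submodule.topologicalClosure_minimal _ (Submodule.span_le.2 ?_)
      (Submodule.isClosed_orthogonal _)
    rintro _ ⟨τ, rfl⟩
    exact Submodule.mem_orthogonal_singleton_iff_inner_left.2 (h τ)
  exact Subtype.ext (inner_self_eq_zero.1
    (Submodule.mem_orthogonal_singleton_iff_inner_left.1 (horth (T.HH_le_closure_span u.2))))

theorem wave_injective : Function.Injective T.wave :=
  (injective_iff_map_eq_zero T.wave).2 fun _ hu =>
    T.eq_zero_of_inner_holCoherentState fun τ => congrFun hu τ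

theorem differentiable_wave (u : T.HH) (σ τ : L) :
    Differentiable ℂ fun z : ℂ => T.wave u (σ + T.cmul z τ) :=
  T.differentiable_inner_holCoherentLp (T.HH_le_closure_span u.2) σ τ

end FieldTheory

/-! ### Total families with equal Gram matrices -/

section gram
variable {𝕜 ι V W : Type*} [RCLike 𝕜] [NormedAddCommGroup V] [InnerProductSpace 𝕜 V]
  [NormedAddCommGroup W] [InnerProductSpace 𝕜 W] {k : ι → V} {k' : ι → W}

theorem norm_linearCombination_eq_of_inner_eq
    (h : ∀ i j, inner 𝕜 (k' i) (k' j) = inner 𝕜 (k i) (k j)) (c : ι →₀ 𝕜) :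
    ‖Finsupp.linearCombination 𝕜 k' c‖ = ‖Finsupp.linearCombination 𝕜 k c‖ := by
  rw [@norm_eq_sqrt_re_inner 𝕜, @norm_eq_sqrt_re_inner 𝕜 V]
  simp only [Finsupp.linearCombination_apply, Finsupp.sum, sum_inner, inner_sum, inner_smul_left,
    inner_smul_right, h]

variable [CompleteSpace V]

theorem denseRange_linearCombination (hk : ∀ u : V, (∀ i, inner 𝕜 (k i) u = 0) → u = 0) :
    DenseRange (Finsupp.linearCombination 𝕜 k) := by
  suffices (LinearMap.range (Finsupp.linearCombination 𝕜 k)).topologicalClosure = ⊤ from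
    Submodule.dense_iff_topologicalClosure_eq_top.2 this
  rw [Submodule.topologicalClosure_eq_top_iff, Finsupp.range_linearCombination, eq_bot_iff]
  exact fun u hu => hk u fun i => hu _ (Submodule.subset_span ⟨i, rfl⟩)

theorem linearIsometryEquiv_ext_of_total
    (hk : ∀ u : V, (∀ i, inner 𝕜 (k i) u = 0) → u = 0) {B B' : V ≃ₗᵢ[𝕜] W}
    (h : ∀ i, B (k i) = B' (k i)) : B = B' :=
  LinearIsometryEquiv.ext <| congrFun <|
    (denseRange_linearCombination hk).equalizer B.continuous B'.continuous <| funext fun c => by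
      simp [Finsupp.linearCombination_apply, Finsupp.sum, h]

variable [CompleteSpace W]

theorem exists_linearIsometryEquiv_of_inner_eq
    (h : ∀ i j, inner 𝕜 (k' i) (k' j) = inner 𝕜 (k i) (k j))
    (hk : ∀ u : V, (∀ i, inner 𝕜 (k i) u = 0) → u = 0)
    (hk' : ∀ u : W, (∀ i, inner 𝕜 (k' i) u = 0) → u = 0) :
    ∃ B : V ≃ₗᵢ[𝕜] W, ∀ i, B (k i) = k' i := by
  refine ⟨(LinearEquiv.refl 𝕜 (ι →₀ 𝕜)).extendOfIsometry (Finsupp.linearCombination 𝕜 k)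
    (Finsupp.linearCombination 𝕜 k') (denseRange_linearCombination hk)
    (denseRange_linearCombination hk') (norm_linearCombination_eq_of_inner_eq h), fun i => ?_⟩
  simpa using LinearEquiv.extendOfIsometry_eq (LinearEquiv.refl 𝕜 (ι →₀ 𝕜))
    (Finsupp.linearCombination 𝕜 k) (Finsupp.linearCombination 𝕜 k')
    (denseRange_linearCombination hk) (denseRange_linearCombination hk')
    (norm_linearCombination_eq_of_inner_eq h) (Finsupp.single i 1)

end gram

/-! ### Coherent states in the Schrödinger representation -/

namespace FieldTheory

variable {L : Type*} [NormedAddCommGroup L] [InnerProductSpace ℝ L] (T : FieldTheory L)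

theorem bracket_of_mem_M {m : L} (hm : m ∈ T.M) (ξ : L) : T.bracket m ξ = ⟪T.J m, ξ⟫_ℝ := by
  rw [inner_J_left, omega_apply, T.mem_M.1 hm ξ]
  ring

theorem inner_J_of_mem_M {m m' : L} (hm : m ∈ T.M) (hm' : m' ∈ T.M) : ⟪T.J m, m'⟫_ℝ = 0 := by
  rw [← T.bracket_of_mem_M hm, T.mem_M.1 hm']

theorem inner_of_mem_JM {a m : L} (ha : a ∈ T.JM) (hm : m ∈ T.M) : ⟪a, m⟫_ℝ = 0 := by
  obtain ⟨m', hm', rfl⟩ := ha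
  exact T.inner_J_of_mem_M hm' hm

theorem inner_J_of_mem_JM {a a' : L} (ha : a ∈ T.JM) (ha' : a' ∈ T.JM) : ⟪T.J a, a'⟫_ℝ = 0 := by
  obtain ⟨m', hm', rfl⟩ := ha'
  rw [inner_J_J]
  exact T.inner_of_mem_JM ha hm'

theorem q_eq_zero {m : L} (hm : m ∈ T.M) : T.q m = 0 :=
  (Submodule.Quotient.mk_eq_zero _).2 hm

variable [CompleteSpace L]

/-- The component `j (q τ)` of `τ` in the decomposition `L = J M ⊕ M`. -/
def fieldPart : L →L[ℝ] L := T.j.comp T.M.mkQL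

/-- The component `τ - j (q τ)` of `τ` in the decomposition `L = J M ⊕ M`. -/
def momentumPart : L →L[ℝ] L := ContinuousLinearMap.id ℝ L - T.fieldPart

theorem fieldPart_mem (τ : L) : T.fieldPart τ ∈ T.JM := T.jLin_mem (T.q τ)

theorem momentumPart_mem (τ : L) : T.momentumPart τ ∈ T.M := T.jLin_q_sub_mem τ

theorem fieldPart_add_momentumPart (τ : L) : T.fieldPart τ + T.momentumPart τ = τ :=
  add_sub_cancel _ τ

theorem fieldPart_of_mem_M {m : L} (hm : m ∈ T.M) : T.fieldPart m = 0 :=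
  (congrArg T.j (T.q_eq_zero hm)).trans (map_zero _)

theorem momentumPart_of_mem_M {m : L} (hm : m ∈ T.M) : T.momentumPart m = m := by
  rw [← zero_add (T.momentumPart m), ← T.fieldPart_of_mem_M hm, fieldPart_add_momentumPart]

theorem inner_eq_inner_fieldPart_add (τ ξ : L) : ⟪τ, ξ⟫_ℝ
    = ⟪T.fieldPart τ, T.fieldPart ξ⟫_ℝ + ⟪T.momentumPart τ, T.momentumPart ξ⟫_ℝ := by
  conv_lhs => rw [← T.fieldPart_add_momentumPart τ, ← T.fieldPart_add_momentumPart ξ]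
  rw [inner_add_left, inner_add_right, inner_add_right,
    T.inner_of_mem_JM (T.fieldPart_mem τ) (T.momentumPart_mem ξ), add_zero, real_inner_comm,
    real_inner_comm (T.fieldPart ξ), real_inner_comm (T.fieldPart τ),
    T.inner_of_mem_JM (T.fieldPart_mem ξ) (T.momentumPart_mem τ), zero_add]

theorem inner_J_eq_inner_J_momentumPart_sub (τ ξ : L) : ⟪T.J τ, ξ⟫_ℝ
    = ⟪T.J (T.momentumPart τ), T.fieldPart ξ⟫_ℝ
      - ⟪T.J (T.momentumPart ξ), T.fieldPart τ⟫_ℝ := by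
  have hswap : ⟪T.J (T.fieldPart τ), T.momentumPart ξ⟫_ℝ
      = -⟪T.J (T.momentumPart ξ), T.fieldPart τ⟫_ℝ := by
    rw [inner_J_left, inner_J_left, T.omega_swap, mul_neg]
  conv_lhs => rw [← T.fieldPart_add_momentumPart τ, ← T.fieldPart_add_momentumPart ξ]
  rw [map_add, inner_add_left, inner_add_right, inner_add_right, hswap,
    T.inner_J_of_mem_JM (T.fieldPart_mem τ) (T.fieldPart_mem ξ),
    T.inner_J_of_mem_M (T.momentumPart_mem τ) (T.momentumPart_mem ξ)]
  ring

theorem inner_fieldPart {a : L} (ha : a ∈ T.JM) (ξ : L) : ⟪a, T.fieldPart ξ⟫_ℝ = ⟪a, ξ⟫_ℝ := by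
  conv_rhs => rw [← T.fieldPart_add_momentumPart ξ]
  rw [inner_add_right, T.inner_of_mem_JM ha (T.momentumPart_mem ξ), add_zero]

theorem dualEmbedding_eq {f : StrongDual ℝ T.Q} {a : L} (h : ∀ ξ, f (T.q ξ) = ⟪a, ξ⟫_ℝ) :
    T.dualEmbedding f = a := by
  change (InnerProductSpace.toDual ℝ L).symm (f.comp T.M.mkQL) = a
  rw [LinearIsometryEquiv.symm_apply_eq]
  ext ξ
  exact h ξ

theorem inner_dualEmbedding (f : StrongDual ℝ T.Q) (ξ : L) :
    ⟪T.dualEmbedding f, ξ⟫_ℝ = f (T.q ξ) :=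
  InnerProductSpace.toDual_symm_apply

theorem dualEmbedding_mem_JM (f : StrongDual ℝ T.Q) : T.dualEmbedding f ∈ T.JM := by
  rw [JM_eq, Submodule.mem_orthogonal]
  intro m hm
  rw [real_inner_comm, inner_dualEmbedding, T.q_eq_zero hm, map_zero]

/-- The functional `Ω(q τ, ·) + i [τ, ·]` in the exponent of `k_τ`. -/
def schrExponent (τ : L) : T.Q →L[ℝ] ℂ :=
  T.Omega (T.q τ) + Complex.I • Complex.ofRealCLM.comp (T.bracketQ τ)

/-- The logarithm `-Ω(q τ, q τ) / 2 - i [τ, τ] / 2` of the normalization factor of `k_τ`. -/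
def schrConst (τ : L) : ℂ :=
  -(1 / 2) * T.Omega (T.q τ) (T.q τ) - Complex.I / 2 * T.bracket τ τ

theorem schrCoherent_apply (τ : L) (φ : Hat T.Q) :
    T.schrCoherent τ φ = Complex.exp (ext (T.schrExponent τ) φ + T.schrConst τ) := rfl

/-- The real part of `schrExponent`, represented by the field part of `τ`. -/
def schrRe (τ : L) : StrongDual ℝ T.Q := (innerSL ℝ (T.fieldPart τ)).comp T.j

/-- The imaginary part of `schrExponent`, represented by `J` of the momentum part of `τ`. -/
def schrIm (τ : L) : StrongDual ℝ T.Q := T.bracketQ (T.momentumPart τ)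

theorem schrRe_apply_q (τ ξ : L) : T.schrRe τ (T.q ξ) = ⟪T.fieldPart τ, ξ⟫_ℝ :=
  T.inner_fieldPart (T.fieldPart_mem τ) ξ

theorem schrIm_apply_q (τ ξ : L) : T.schrIm τ (T.q ξ) = ⟪T.J (T.momentumPart τ), ξ⟫_ℝ :=
  T.bracket_of_mem_M (T.momentumPart_mem τ) ξ

theorem dualEmbedding_schrRe (τ : L) : T.dualEmbedding (T.schrRe τ) = T.fieldPart τ :=
  T.dualEmbedding_eq (T.schrRe_apply_q τ)

theorem dualEmbedding_schrIm (τ : L) : T.dualEmbedding (T.schrIm τ) = T.J (T.momentumPart τ) :=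
  T.dualEmbedding_eq (T.schrIm_apply_q τ)

theorem schrRe_of_mem_M {m : L} (hm : m ∈ T.M) : T.schrRe m = 0 := by
  rw [schrRe, T.fieldPart_of_mem_M hm, map_zero, ContinuousLinearMap.zero_comp]

theorem exists_mem_M_schrIm_eq (f : StrongDual ℝ T.Q) : ∃ m ∈ T.M, T.schrIm m = f := by
  obtain ⟨m, hm, hmf⟩ := T.dualEmbedding_mem_JM f
  refine ⟨m, hm, ?_⟩
  ext φ
  obtain ⟨ξ, rfl⟩ := T.M.mkQ_surjective φ
  rw [schrIm_apply_q, T.momentumPart_of_mem_M hm, hmf, inner_dualEmbedding]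

theorem schrExponent_eq (τ : L) : T.schrExponent τ = Complex.ofRealCLM.comp (T.schrRe τ)
    + Complex.I • Complex.ofRealCLM.comp (T.schrIm τ) := by
  ext φ
  obtain ⟨ξ, rfl⟩ := T.M.mkQ_surjective φ
  have hparts : T.bracket τ ξ = T.bracket (T.fieldPart τ) ξ + T.bracket (T.momentumPart τ) ξ := by
    rw [← add_apply, ← map_add, fieldPart_add_momentumPart]
  have hOmega : T.Omega (T.q τ) (T.q ξ)
      = T.schrRe τ (T.q ξ) - Complex.I * T.bracket (T.fieldPart τ) ξ := T.Omega_apply _ _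
  have hIm : T.schrIm τ (T.q ξ) = T.bracket (T.momentumPart τ) ξ := rfl
  simp only [schrExponent, add_apply, FunLike.coe_smul, Pi.smul_apply,
    ContinuousLinearMap.comp_apply, Complex.ofRealCLM_apply, smul_eq_mul, hOmega, hIm,
    bracketQ_q, hparts]
  push_cast
  ring

theorem ext_schrExponent (τ : L) (φ : Hat T.Q) :
    ext (T.schrExponent τ) φ = (φ (T.schrRe τ) : ℂ) + φ (T.schrIm τ) * Complex.I := by
  rw [schrExponent_eq, ext_add, ext_smul, ext_ofReal_comp, ext_ofReal_comp, mul_comm Complex.I]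

theorem schrConst_eq (τ : L) : T.schrConst τ = (-(1 / 2) * ‖T.fieldPart τ‖ ^ 2 : ℝ)
    - (1 / 2 * ⟪T.J (T.momentumPart τ), T.fieldPart τ⟫_ℝ : ℝ) * Complex.I := by
  have hparts : T.bracket τ τ = T.bracket (T.fieldPart τ) τ
      + ⟪T.J (T.momentumPart τ), T.fieldPart τ⟫_ℝ := by
    nth_rw 1 [← T.fieldPart_add_momentumPart τ]
    rw [map_add, add_apply, T.bracket_of_mem_M (T.momentumPart_mem τ),
      T.inner_fieldPart ⟨_, T.momentumPart_mem τ, rfl⟩]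
  have hOmega : T.Omega (T.q τ) (T.q τ) = (⟪T.fieldPart τ, T.fieldPart τ⟫_ℝ : ℂ)
      - Complex.I * T.bracket (T.fieldPart τ) τ := T.Omega_apply _ _
  rw [schrConst, hOmega, hparts, real_inner_self_eq_norm_sq]
  push_cast
  ring

theorem schrCoherentState_ae_eq (τ : L) :
    T.schrCoherentState τ =ᵐ[T.nuQ] T.schrCoherent τ := MemLp.coeFn_toLp _

theorem inner_schrCoherentState (τ : L) {u : T.HS} {ψ : Hat T.Q → ℂ} (hu : u =ᵐ[T.nuQ] ψ) :
    ⟪T.schrCoherentState τ, u⟫_ℂ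
      = ∫ φ, (starRingEnd ℂ) (T.schrCoherent τ φ) * ψ φ ∂T.nuQ := by
  rw [L2.inner_def]
  refine integral_congr_ae ?_
  filter_upwards [T.schrCoherentState_ae_eq τ, hu] with φ hφ hu
  rw [hφ, hu, RCLike.inner_apply, mul_comm]

theorem conj_schrCoherent_mul_schrCoherent (τ σ : L) (φ : Hat T.Q) :
    (starRingEnd ℂ) (T.schrCoherent τ φ) * T.schrCoherent σ φ
      = Complex.exp ((φ (T.schrRe τ + T.schrRe σ) : ℂ)
          + φ (T.schrIm σ - T.schrIm τ) * Complex.I)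
        * Complex.exp ((starRingEnd ℂ) (T.schrConst τ) + T.schrConst σ) := by
  rw [schrCoherent_apply, schrCoherent_apply, ← Complex.exp_conj, ← Complex.exp_add,
    ← Complex.exp_add, ext_schrExponent, ext_schrExponent]
  congr 1
  simp only [map_add, map_sub, map_mul, Complex.conj_ofReal, Complex.conj_I]
  push_cast
  ring

theorem inner_schrCoherentState_schrCoherentState (τ σ : L) :
    ⟪T.schrCoherentState τ, T.schrCoherentState σ⟫_ℂ
      = Complex.exp (-(1 / 4) * (‖τ‖ ^ 2 + ‖σ‖ ^ 2) + 1 / 2 * T.herm σ τ) := by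
  rw [T.inner_schrCoherentState τ (T.schrCoherentState_ae_eq σ)]
  simp only [conj_schrCoherent_mul_schrCoherent]
  rw [integral_mul_const, T.isHatGaussian_nuQ.integral_exp_add_mul_I T.dualEmbedding,
    ← Complex.exp_add, T.dualEmbedding.map_add, T.dualEmbedding.map_sub]
  simp only [dualEmbedding_schrRe, dualEmbedding_schrIm, schrConst_eq, herm_eq_inner,
    ← Complex.ofReal_pow, ← real_inner_self_eq_norm_sq]
  rw [T.inner_eq_inner_fieldPart_add τ τ, T.inner_eq_inner_fieldPart_add σ σ,
    T.inner_eq_inner_fieldPart_add σ τ, T.inner_J_eq_inner_J_momentumPart_sub σ τ]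
  congr 1
  simp only [inner_add_left, inner_add_right, inner_sub_left, inner_sub_right, inner_J_J,
    real_inner_comm (T.fieldPart τ), real_inner_comm (T.momentumPart τ),
    real_inner_comm (T.fieldPart σ) (T.J _), map_sub, map_mul, Complex.conj_ofReal,
    Complex.conj_I]
  push_cast
  ring

theorem eq_zero_of_inner_schrCoherentState {u : T.HS}
    (h : ∀ τ, ⟪T.schrCoherentState τ, u⟫_ℂ = 0) : u = 0 := by
  have := T.isHatGaussian_nuQ.isProbabilityMeasure
  have hu : Integrable u T.nuQ := (Lp.memLp u).integrable (by norm_num)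
  refine Lp.ext ((ae_eq_zero_of_integral_exp_mul hu fun f => ?_).trans (Lp.coeFn_zero _ _ _).symm)
  obtain ⟨m, hm, hf⟩ := T.exists_mem_M_schrIm_eq (-f)
  have hk (φ : Hat T.Q) : (starRingEnd ℂ) (T.schrCoherent m φ) * u φ
      = (starRingEnd ℂ) (Complex.exp (T.schrConst m)) *
        (Complex.exp (φ f * Complex.I) * u φ) := by
    rw [schrCoherent_apply, ext_schrExponent, T.schrRe_of_mem_M hm, hf, Complex.exp_add, map_mul,
      ← Complex.exp_conj]
    simp only [map_zero, map_neg, map_mul, Complex.ofReal_zero, Complex.ofReal_neg, zero_add,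
      Complex.conj_ofReal, Complex.conj_I, neg_mul_neg]
    ring
  have hint := h m
  simp only [T.inner_schrCoherentState m EventuallyEq.rfl, hk, integral_const_mul] at hint
  exact (mul_eq_zero.1 hint).resolve_left
    ((map_ne_zero (starRingEnd ℂ)).2 (Complex.exp_ne_zero _))

/-! ### The Segal–Bargmann transform -/

theorem inner_holNormalizedState (τ : L) (u : T.HH) :
    ⟪T.holNormalizedState τ, u⟫_ℂ
      = Complex.exp (-(1 / 4) * (‖τ‖ ^ 2 : ℝ)) * T.wave u τ := by
  refine (inner_smul_left (T.holCoherentState τ) u _).trans ?_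
  rw [← Complex.exp_conj, real_inner_self_eq_norm_sq, wave_apply]
  congr 2
  simp [Complex.conj_ofNat]

theorem wave_holCoherentState (σ : L) : T.wave (T.holCoherentState σ) = T.holCoherent σ :=
  funext fun τ => T.inner_holCoherentLp_holCoherentLp τ σ

theorem inner_holNormalizedState_holNormalizedState (τ σ : L) :
    ⟪T.holNormalizedState τ, T.holNormalizedState σ⟫_ℂ
      = ⟪T.schrCoherentState τ, T.schrCoherentState σ⟫_ℂ := by
  rw [inner_schrCoherentState_schrCoherentState, inner_holNormalizedState, holNormalizedState,
    map_smul, Pi.smul_apply, wave_holCoherentState, holCoherent, smul_eq_mul, ← Complex.exp_add,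
    ← Complex.exp_add, real_inner_self_eq_norm_sq]
  congr 1
  push_cast
  ring

theorem eq_zero_of_inner_holNormalizedState {u : T.HH}
    (h : ∀ τ, ⟪T.holNormalizedState τ, u⟫_ℂ = 0) : u = 0 :=
  T.eq_zero_of_inner_holCoherentState fun τ =>
    (mul_eq_zero.1 ((T.inner_holNormalizedState τ u).symm.trans (h τ))).resolve_left
      (Complex.exp_ne_zero _)

theorem exists_segalBargmann : ∃ B : T.HS ≃ₗᵢ[ℂ] T.HH,
    ∀ τ, B (T.schrCoherentState τ) = T.holNormalizedState τ := by
  have : CompleteSpace T.HH := (Submodule.isClosed_topologicalClosure _).completeSpace_coe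
  exact exists_linearIsometryEquiv_of_inner_eq T.inner_holNormalizedState_holNormalizedState
    (fun _ => T.eq_zero_of_inner_schrCoherentState)
    (fun _ => T.eq_zero_of_inner_holNormalizedState)

/-- The Segal–Bargmann transform from the Schrödinger to the holomorphic representation: the
isometry that maps `k_τ` to the normalized coherent state of `τ`. -/
def segalBargmann : T.HS ≃ₗᵢ[ℂ] T.HH := T.exists_segalBargmann.choose

theorem segalBargmann_schrCoherentState (τ : L) :
    T.segalBargmann (T.schrCoherentState τ) = T.holNormalizedState τ :=
  T.exists_segalBargmann.choose_spec τ

theorem eq_segalBargmann {B : T.HS ≃ₗᵢ[ℂ] T.HH}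
    (hB : ∀ τ, B (T.schrCoherentState τ) = T.holNormalizedState τ) : B = T.segalBargmann :=
  linearIsometryEquiv_ext_of_total (fun _ => T.eq_zero_of_inner_schrCoherentState)
    fun τ => (hB τ).trans (T.segalBargmann_schrCoherentState τ).symm

theorem inner_schrCoherentState_eq_wave (τ : L) (u : T.HS) :
    ⟪T.schrCoherentState τ, u⟫_ℂ
      = Complex.exp (-(1 / 4) * (‖τ‖ ^ 2 : ℝ)) * T.wave (T.segalBargmann u) τ := by
  rw [← inner_holNormalizedState, ← segalBargmann_schrCoherentState,
    LinearIsometryEquiv.inner_map_map]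

end FieldTheory

/-! ### Exponential bounds and exponential polynomials on `Hat E` -/

section expBound
variable {E : Type*} [SeminormedAddCommGroup E] [NormedSpace ℝ E]

/-- The exponential of a sum of absolute values of continuous linear functionals.  Such functions
are integrable for Gaussian measures and serve as dominating functions. -/
def expBound (s : List (StrongDual ℝ E)) (x : Hat E) : ℝ :=
  Real.exp ((s.map fun f => |x f|).sum)

theorem expBound_nil (x : Hat E) : expBound [] x = 1 := by simp [expBound]

theorem expBound_cons (f : StrongDual ℝ E) (s : List (StrongDual ℝ E)) (x : Hat E) :
    expBound (f :: s) x = Real.exp |x f| * expBound s x := by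
  simp [expBound, Real.exp_add]

theorem expBound_append (s t : List (StrongDual ℝ E)) (x : Hat E) :
    expBound (s ++ t) x = expBound s x * expBound t x := by
  simp [expBound, Real.exp_add]

theorem one_le_expBound (s : List (StrongDual ℝ E)) (x : Hat E) : 1 ≤ expBound s x := by
  refine Real.one_le_exp (List.sum_nonneg fun y hy => ?_)
  obtain ⟨f, -, rfl⟩ := List.mem_map.1 hy
  exact abs_nonneg _

theorem measurable_expBound (s : List (StrongDual ℝ E)) : Measurable (expBound s) := by
  induction s with
  | nil => simp only [funext expBound_nil, measurable_const]
  | cons f s ih =>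
    simp only [funext (expBound_cons f s)]
    exact (Real.measurable_exp.comp (measurable_eval f).abs).mul ih

theorem exp_norm_ext_le_expBound (l : E →L[ℝ] ℂ) (x : Hat E) :
    Real.exp ‖ext l x‖ ≤ expBound [Complex.reCLM.comp l, Complex.imCLM.comp l] x := by
  refine Real.exp_le_exp.2 ?_
  calc ‖ext l x‖ ≤ ‖(x (Complex.reCLM.comp l) : ℂ)‖
        + ‖(x (Complex.imCLM.comp l) : ℂ) * Complex.I‖ := norm_add_le _ _
    _ = _ := by simp

theorem IsHatGaussian.integrable_expBound_mul_exp {ν : Measure (Hat E)} {v : ℝ≥0}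
    (hν : IsHatGaussian ν v) (s : List (StrongDual ℝ E)) (g : StrongDual ℝ E) :
    Integrable (fun x => expBound s x * Real.exp (x g)) ν := by
  induction s generalizing g with
  | nil => simpa only [expBound_nil, one_mul] using hν.integrable_exp g
  | cons f s ih =>
    refine ((ih (g + f)).add (ih (g - f))).mono' ((measurable_expBound _).mul
      (Real.measurable_exp.comp (measurable_eval g))).aestronglyMeasurable (ae_of_all _ fun x => ?_)
    have hs : 0 ≤ expBound s x := zero_le_one.trans (one_le_expBound s x)
    rw [expBound_cons, Real.norm_of_nonneg (by positivity), Pi.add_apply, map_add, map_sub,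
      Real.exp_add, sub_eq_add_neg, Real.exp_add]
    calc Real.exp |x f| * expBound s x * Real.exp (x g)
        ≤ (Real.exp (x f) + Real.exp (-x f)) * expBound s x * Real.exp (x g) := by
          gcongr
          exact Real.exp_abs_le (x f)
      _ = _ := by ring

theorem IsHatGaussian.integrable_expBound {ν : Measure (Hat E)} {v : ℝ≥0}
    (hν : IsHatGaussian ν v) (s : List (StrongDual ℝ E)) : Integrable (expBound s) ν := by
  simpa using hν.integrable_expBound_mul_exp s 0

/-- A family of functions on `Hat E` dominated by a multiple of a single `expBound`, uniformly for
parameters in `[-1, 1]`.  A single function is treated as a constant family. -/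
def IsExpBounded (Φ : ℝ → Hat E → ℂ) : Prop :=
  ∃ (C : ℝ) (s : List (StrongDual ℝ E)), 0 ≤ C ∧ ∀ t, |t| ≤ 1 → ∀ x, ‖Φ t x‖ ≤ C * expBound s x

namespace IsExpBounded
variable {Φ Ψ : ℝ → Hat E → ℂ}

theorem mul (hΦ : IsExpBounded Φ) (hΨ : IsExpBounded Ψ) :
    IsExpBounded fun t x => Φ t x * Ψ t x := by
  obtain ⟨C, s, hC, hΦs⟩ := hΦ
  obtain ⟨D, r, hD, hΨr⟩ := hΨ
  refine ⟨C * D, s ++ r, by positivity, fun t ht x => ?_⟩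
  have hs := one_le_expBound s x
  rw [norm_mul, expBound_append, mul_mul_mul_comm]
  exact mul_le_mul (hΦs t ht x) (hΨr t ht x) (norm_nonneg _) (by positivity)

theorem add (hΦ : IsExpBounded Φ) (hΨ : IsExpBounded Ψ) :
    IsExpBounded fun t x => Φ t x + Ψ t x := by
  obtain ⟨C, s, hC, hΦs⟩ := hΦ
  obtain ⟨D, r, hD, hΨr⟩ := hΨ
  refine ⟨C + D, s ++ r, by positivity, fun t ht x => ?_⟩
  have hs := one_le_expBound s x
  have hr := one_le_expBound r x
  rw [expBound_append]
  calc ‖Φ t x + Ψ t x‖ ≤ C * expBound s x + D * expBound r x :=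
        (norm_add_le _ _).trans (add_le_add (hΦs t ht x) (hΨr t ht x))
    _ ≤ C * (expBound s x * expBound r x) + D * (expBound s x * expBound r x) := by
        gcongr
        · exact le_mul_of_one_le_right (by positivity) hr
        · exact le_mul_of_one_le_left (by positivity) hs
    _ = _ := by ring

theorem conj (hΦ : IsExpBounded Φ) : IsExpBounded fun t x => (starRingEnd ℂ) (Φ t x) := by
  obtain ⟨C, s, hC, hΦs⟩ := hΦ
  exact ⟨C, s, hC, fun t ht x => by simpa only [RCLike.norm_conj] using hΦs t ht x⟩

theorem of_norm_le_exp_norm_ext (l : E →L[ℝ] ℂ)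
    (h : ∀ t, |t| ≤ 1 → ∀ x, ‖Φ t x‖ ≤ Real.exp ‖ext l x‖) : IsExpBounded Φ :=
  ⟨1, _, zero_le_one, fun t ht x => by
    simpa only [one_mul] using (h t ht x).trans (exp_norm_ext_le_expBound l x)⟩

theorem const (c : ℂ) : IsExpBounded fun (_ : ℝ) (_ : Hat E) => c :=
  ⟨‖c‖, [], norm_nonneg c, fun t _ x => by simp [expBound_nil]⟩

theorem param : IsExpBounded fun (t : ℝ) (_ : Hat E) => (t : ℂ) :=
  ⟨1, [], zero_le_one, fun t ht x => by simpa [expBound_nil] using ht⟩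

theorem exp_param_mul (c : ℂ) : IsExpBounded fun (t : ℝ) (_ : Hat E) => Complex.exp (t * c) :=
  ⟨Real.exp ‖c‖, [], by positivity, fun t ht x => by
    rw [expBound_nil, mul_one]
    refine (Complex.norm_exp_le_exp_norm _).trans ?_
    rw [norm_mul, Complex.norm_real, Real.norm_eq_abs]
    exact Real.exp_le_exp.2 (mul_le_of_le_one_left (norm_nonneg _) ht)⟩

theorem eval (l : E →L[ℝ] ℂ) : IsExpBounded fun (_ : ℝ) (x : Hat E) => ext l x :=
  of_norm_le_exp_norm_ext l fun _ _ x =>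
    (le_add_of_nonneg_right zero_le_one).trans (Real.add_one_le_exp ‖ext l x‖)

theorem exp_param_mul_eval (l : E →L[ℝ] ℂ) :
    IsExpBounded fun (t : ℝ) (x : Hat E) => Complex.exp (t * ext l x) :=
  of_norm_le_exp_norm_ext l fun t ht x => by
    refine (Complex.norm_exp_le_exp_norm _).trans ?_
    rw [norm_mul, Complex.norm_real, Real.norm_eq_abs]
    exact Real.exp_le_exp.2 (mul_le_of_le_one_left (norm_nonneg _) ht)

theorem exp_eval (l : E →L[ℝ] ℂ) :
    IsExpBounded fun (_ : ℝ) (x : Hat E) => Complex.exp (ext l x) :=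
  of_norm_le_exp_norm_ext l fun _ _ _ => Complex.norm_exp_le_exp_norm _

variable {ν : Measure (Hat E)} {v : ℝ≥0}

theorem integrable (hΦ : IsExpBounded Φ) (hν : IsHatGaussian ν v) (hm : Measurable (Φ 0)) :
    Integrable (Φ 0) ν := by
  obtain ⟨C, s, -, hΦs⟩ := hΦ
  exact ((hν.integrable_expBound s).const_mul C).mono' hm.aestronglyMeasurable
    (ae_of_all _ fun x => hΦs 0 (by simp) x)

theorem memLp_two (hΦ : IsExpBounded Φ) (hν : IsHatGaussian ν v) (hm : Measurable (Φ 0)) :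
    MemLp (Φ 0) 2 ν := by
  rw [memLp_two_iff_integrable_sq_norm hm.aestronglyMeasurable]
  have hsq := ((hΦ.mul hΦ).integrable hν (hm.mul hm)).norm
  simpa only [norm_mul, pow_two] using hsq

theorem hasDerivAt_integral {Φ' : ℝ → Hat E → ℂ} (hΦ : IsExpBounded Φ) (hΦ' : IsExpBounded Φ')
    (hν : IsHatGaussian ν v) (hm : ∀ t, Measurable (Φ t)) (hm' : Measurable (Φ' 0))
    (hd : ∀ x t, HasDerivAt (fun t => Φ t x) (Φ' t x) t) :
    HasDerivAt (fun t => ∫ x, Φ t x ∂ν) (∫ x, Φ' 0 x ∂ν) 0 := by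
  obtain ⟨C, s, -, hΦ's⟩ := hΦ'
  exact (hasDerivAt_integral_of_dominated_loc_of_deriv_le (Metric.ball_mem_nhds 0 one_pos)
    (Eventually.of_forall fun t => (hm t).aestronglyMeasurable) (hΦ.integrable hν (hm 0))
    hm'.aestronglyMeasurable
    (ae_of_all _ fun x t ht => hΦ's t (by simpa using (mem_ball_zero_iff.1 ht).le) x)
    ((hν.integrable_expBound s).const_mul C) (ae_of_all _ fun x t _ => hd x t)).2

end IsExpBounded
end expBound

section expPoly
variable {E : Type*} [SeminormedAddCommGroup E] [NormedSpace ℝ E]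

/-- Exponential polynomials on `Hat E`: linear combinations of products of (the extensions of)
continuous linear functionals with exponentials of continuous affine functionals. -/
inductive IsExpPoly : (Hat E → ℂ) → Prop
  | exp (l : E →L[ℝ] ℂ) (c : ℂ) : IsExpPoly fun x => Complex.exp (ext l x + c)
  | ext_mul (l : E →L[ℝ] ℂ) {ψ : Hat E → ℂ} : IsExpPoly ψ → IsExpPoly fun x => ext l x * ψ x
  | add {ψ χ : Hat E → ℂ} : IsExpPoly ψ → IsExpPoly χ → IsExpPoly fun x => ψ x + χ x
  | const_mul (c : ℂ) {ψ : Hat E → ℂ} : IsExpPoly ψ → IsExpPoly fun x => c * ψ x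

theorem hasDerivAt_ext_add_smul (l : E →L[ℝ] ℂ) (x y : Hat E) (t : ℝ) :
    HasDerivAt (fun t : ℝ => ext l (x + t • y)) (ext l y) t := by
  simp only [ext_add_right, ext_smul_right]
  simpa using ((hasDerivAt_id t).ofReal_comp.mul_const (ext l y)).const_add (ext l x)

namespace IsExpPoly
variable {ψ χ : Hat E → ℂ}

theorem zero : IsExpPoly (0 : Hat E → ℂ) := by
  simpa using! const_mul 0 (exp (0 : E →L[ℝ] ℂ) 0)

theorem measurable (hψ : IsExpPoly ψ) : Measurable ψ := by
  induction hψ with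
  | exp l c => exact Complex.measurable_exp.comp ((measurable_ext l).add_const c)
  | ext_mul l _ ih => exact (measurable_ext l).mul ih
  | add _ _ ihψ ihχ => exact ihψ.add ihχ
  | const_mul c _ ih => exact ih.const_mul c

theorem isExpBounded_translate (hψ : IsExpPoly ψ) (y : Hat E) :
    IsExpBounded fun t x => ψ (x + t • y) := by
  induction hψ with
  | exp l c =>
    simp only [ext_add_right, ext_smul_right, Complex.exp_add]
    exact ((IsExpBounded.exp_eval l).mul (.exp_param_mul _)).mul (.const _)
  | ext_mul l _ ih =>
    simp only [ext_add_right, ext_smul_right]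
    exact ((IsExpBounded.eval l).add (IsExpBounded.param.mul (.const _))).mul ih
  | add _ _ ihψ ihχ => exact ihψ.add ihχ
  | const_mul c _ ih => exact (IsExpBounded.const c).mul ih

theorem isExpBounded (hψ : IsExpPoly ψ) : IsExpBounded fun _ x => ψ x := by
  simpa using hψ.isExpBounded_translate 0

theorem exists_hasDerivAt (hψ : IsExpPoly ψ) (y : Hat E) :
    ∃ ψ' : Hat E → ℂ, IsExpPoly ψ' ∧
      ∀ x (t : ℝ), HasDerivAt (fun t : ℝ => ψ (x + t • y)) (ψ' (x + t • y)) t := by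
  induction hψ with
  | exp l c =>
    refine ⟨fun x => ext l y * Complex.exp (ext l x + c), const_mul _ (exp l c), fun x t => ?_⟩
    simp only [mul_comm (ext l y)]
    exact ((hasDerivAt_ext_add_smul l x y t).add_const c).cexp
  | ext_mul l hψ ih =>
    obtain ⟨ψ', hψ', hd⟩ := ih
    exact ⟨fun x => ext l y * _ + ext l x * ψ' x, add (const_mul _ hψ) (ext_mul l hψ'),
      fun x t => (hasDerivAt_ext_add_smul l x y t).mul (hd x t)⟩
  | add _ _ ihψ ihχ =>
    obtain ⟨ψ', hψ', hdψ⟩ := ihψ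
    obtain ⟨χ', hχ', hdχ⟩ := ihχ
    exact ⟨_, add hψ' hχ', fun x t => (hdψ x t).add (hdχ x t)⟩
  | const_mul c _ ih =>
    obtain ⟨ψ', hψ', hd⟩ := ih
    exact ⟨_, const_mul c hψ', fun x t => (hd x t).const_mul c⟩

theorem hasDerivAt (hψ : IsExpPoly ψ) (x y : Hat E) (t : ℝ) :
    HasDerivAt (fun t : ℝ => ψ (x + t • y)) (lineDeriv ℝ ψ (x + t • y) y) t := by
  obtain ⟨ψ', -, hd⟩ := hψ.exists_hasDerivAt y
  have hline : HasLineDerivAt ℝ ψ (ψ' (x + t • y)) (x + t • y) y := by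
    simpa only [HasLineDerivAt, zero_smul, add_zero] using hd (x + t • y) 0
  rw [hline.lineDeriv]
  exact hd x t

theorem hasLineDerivAt (hψ : IsExpPoly ψ) (x y : Hat E) :
    HasLineDerivAt ℝ ψ (lineDeriv ℝ ψ x y) x y := by
  simpa only [HasLineDerivAt, zero_smul, add_zero] using hψ.hasDerivAt x y 0

theorem isExpPoly_lineDeriv (hψ : IsExpPoly ψ) (y : Hat E) :
    IsExpPoly fun x => lineDeriv ℝ ψ x y := by
  obtain ⟨ψ', hψ', hd⟩ := hψ.exists_hasDerivAt y
  convert hψ' using 2 with x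
  exact (hψ.hasLineDerivAt x y).unique <| by
    simpa only [HasLineDerivAt, zero_smul, add_zero] using hd x 0

theorem lineDeriv_add (hψ : IsExpPoly ψ) (hχ : IsExpPoly χ) (x y : Hat E) :
    lineDeriv ℝ (ψ + χ) x y = lineDeriv ℝ ψ x y + lineDeriv ℝ χ x y := by
  have hadd : HasLineDerivAt ℝ (ψ + χ) (lineDeriv ℝ ψ x y + lineDeriv ℝ χ x y) x y :=
    HasDerivAt.add (hψ.hasLineDerivAt x y) (hχ.hasLineDerivAt x y)
  exact hadd.lineDeriv

variable {ν : Measure (Hat E)} {v : ℝ≥0}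

theorem memLp_two (hψ : IsExpPoly ψ) (hν : IsHatGaussian ν v) : MemLp ψ 2 ν :=
  hψ.isExpBounded.memLp_two hν hψ.measurable

theorem hasDerivAt_integral_mul_translate (hψ : IsExpPoly ψ) {κ : Hat E → ℂ}
    (hκ : IsExpBounded fun _ x => κ x) (hκm : Measurable κ) (hν : IsHatGaussian ν v)
    (l : E →L[ℝ] ℂ) (y : Hat E) :
    HasDerivAt (fun t : ℝ => ∫ x, κ x * (Complex.exp (t * ext l x) * ψ (x + t • y)) ∂ν)
      (∫ x, κ x * (ext l x * ψ x + lineDeriv ℝ ψ x y) ∂ν) 0 := by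
  have hψ' := hψ.isExpPoly_lineDeriv y
  have hexp : IsExpBounded fun t (x : Hat E) => Complex.exp (t * ext l x) := .exp_param_mul_eval l
  have htr (t : ℝ) : Measurable fun x : Hat E => x + t • y := measurable_add_right_hat _
  have hexpm (t : ℝ) : Measurable fun x : Hat E => Complex.exp (t * ext l x) :=
    Complex.measurable_exp.comp ((measurable_ext l).const_mul _)
  have hd := (hκ.mul (hexp.mul (hψ.isExpBounded_translate y))).hasDerivAt_integral
    (hκ.mul (((hexp.mul (.eval l)).mul (hψ.isExpBounded_translate y)).add
      (hexp.mul (hψ'.isExpBounded_translate y)))) hν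
    (fun t => hκm.mul ((hexpm t).mul (hψ.measurable.comp (htr t))))
    (hκm.mul ((((hexpm 0).mul (measurable_ext l)).mul (hψ.measurable.comp (htr 0))).add
      ((hexpm 0).mul (hψ'.measurable.comp (htr 0)))))
    fun x t => by
      refine HasDerivAt.const_mul _ (HasDerivAt.mul ?_ (hψ.hasDerivAt x y t))
      simpa using ((hasDerivAt_id t).ofReal_comp.mul_const (ext l x)).cexp
  simpa using hd

end IsExpPoly
end expPoly

theorem hasDerivAt_exp_neg_norm_sq_sub_smul {H : Type*} [NormedAddCommGroup H]
    [InnerProductSpace ℝ H] (x y : H) :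
    HasDerivAt (fun t : ℝ => Complex.exp (-(1 / 4) * (‖x - t • y‖ ^ 2 : ℝ)))
      (Complex.exp (-(1 / 4) * (‖x‖ ^ 2 : ℝ)) * (1 / 2 * ⟪x, y⟫_ℝ)) 0 := by
  have hline : HasDerivAt (fun t : ℝ => x - t • y) (-y) 0 := by
    simpa using ((hasDerivAt_id (0 : ℝ)).smul_const y).const_sub x
  convert (hline.norm_sq.ofReal_comp.const_mul (-(1 / 4) : ℂ)).cexp using 1
  simp only [zero_smul, sub_zero, inner_neg_right]
  push_cast
  ring

namespace FieldTheory

variable {L : Type*} [NormedAddCommGroup L] [InnerProductSpace ℝ L] (T : FieldTheory L)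
  [CompleteSpace L]

/-! ### Observables in the Schrödinger representation -/

theorem schrQuant_apply (F : StrongDual ℝ L) (ψ : Hat T.Q → ℂ) (φ : Hat T.Q) :
    T.schrQuant F ψ φ = Complex.I * (ext (T.schrExponent (T.ham F)) φ * ψ φ
      + lineDeriv ℝ ψ φ (-incl (T.q (T.ham F)))) := by
  have hmul : -Complex.ofRealCLM.comp (T.bracketQ (T.ham F))
      + Complex.I • T.Omega (T.q (T.ham F)) = Complex.I • T.schrExponent (T.ham F) := by
    ext φ
    simp only [schrExponent, add_apply, neg_apply, FunLike.coe_smul, Pi.smul_apply,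
      ContinuousLinearMap.comp_apply, Complex.ofRealCLM_apply, smul_eq_mul]
    linear_combination -(T.bracketQ (T.ham F) φ : ℂ) * Complex.I_sq
  rw [schrQuant, hmul, ext_smul, lineDeriv_neg]
  ring

theorem isExpPoly_schrCoherent (τ : L) : IsExpPoly (T.schrCoherent τ) := IsExpPoly.exp _ _

theorem isExpPoly_schrQuant (F : StrongDual ℝ L) {ψ : Hat T.Q → ℂ} (hψ : IsExpPoly ψ) :
    IsExpPoly (T.schrQuant F ψ) := by
  rw [funext (T.schrQuant_apply F ψ)]
  exact ((IsExpPoly.ext_mul _ hψ).add (hψ.isExpPoly_lineDeriv _)).const_mul _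

theorem schrQuant_add (F : StrongDual ℝ L) {ψ χ : Hat T.Q → ℂ} (hψ : IsExpPoly ψ)
    (hχ : IsExpPoly χ) : T.schrQuant F (ψ + χ) = T.schrQuant F ψ + T.schrQuant F χ := by
  funext φ
  simp only [schrQuant_apply, Pi.add_apply, hψ.lineDeriv_add hχ]
  ring

theorem schrQuant_smul (F : StrongDual ℝ L) (c : ℂ) (ψ : Hat T.Q → ℂ) :
    T.schrQuant F (c • ψ) = c • T.schrQuant F ψ := by
  funext φ
  have hsmul (y : Hat T.Q) : lineDeriv ℝ (c • ψ) φ y = c * lineDeriv ℝ ψ φ y :=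
    deriv_const_mul_field c
  simp only [schrQuant_apply, Pi.smul_apply, hsmul, smul_eq_mul]
  ring

theorem isExpPoly_of_mem_schrCPFun {ψ : Hat T.Q → ℂ} (hψ : ψ ∈ T.schrCPFun) : IsExpPoly ψ := by
  induction hψ using Submodule.span_induction with
  | mem ψ hψ =>
    obtain ⟨⟨s, τ⟩, rfl⟩ := hψ
    induction s with
    | nil => exact T.isExpPoly_schrCoherent τ
    | cons F s ih => exact T.isExpPoly_schrQuant F ih
  | zero => exact IsExpPoly.zero
  | add ψ χ _ _ ihψ ihχ => exact ihψ.add ihχ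
  | smul c ψ _ ih => exact ih.const_mul c

theorem memLp_of_mem_schrCPFun {ψ : Hat T.Q → ℂ} (hψ : ψ ∈ T.schrCPFun) : MemLp ψ 2 T.nuQ :=
  (T.isExpPoly_of_mem_schrCPFun hψ).memLp_two T.isHatGaussian_nuQ

theorem foldr_schrQuant_mem_schrCPFun (s : List (StrongDual ℝ L)) (τ : L) :
    s.foldr T.schrQuant (T.schrCoherent τ) ∈ T.schrCPFun :=
  Submodule.subset_span ⟨(s, τ), rfl⟩

theorem schrQuant_mem_schrCPFun (F : StrongDual ℝ L) {ψ : Hat T.Q → ℂ} (hψ : ψ ∈ T.schrCPFun) :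
    T.schrQuant F ψ ∈ T.schrCPFun := by
  induction hψ using Submodule.span_induction with
  | mem ψ hψ =>
    obtain ⟨⟨s, τ⟩, rfl⟩ := hψ
    exact T.foldr_schrQuant_mem_schrCPFun (F :: s) τ
  | zero =>
    have hzero := T.schrQuant_smul F 0 0
    rw [zero_smul, zero_smul] at hzero
    rw [hzero]
    exact zero_mem _
  | add ψ χ hψ hχ ihψ ihχ =>
    rw [T.schrQuant_add F (T.isExpPoly_of_mem_schrCPFun hψ) (T.isExpPoly_of_mem_schrCPFun hχ)]
    exact add_mem ihψ ihχ
  | smul c ψ _ ih =>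
    rw [T.schrQuant_smul F c]
    exact Submodule.smul_mem _ c ih

/-- The state represented by a reduced wave function in `schrCPFun`. -/
def schrState : T.schrCPFun →ₗ[ℂ] T.HS where
  toFun ψ := (T.memLp_of_mem_schrCPFun ψ.2).toLp
  map_add' _ _ := MemLp.toLp_add _ _
  map_smul' c _ := MemLp.toLp_const_smul c _

theorem schrState_ae_eq (ψ : T.schrCPFun) : T.schrState ψ =ᵐ[T.nuQ] (ψ : Hat T.Q → ℂ) :=
  (T.memLp_of_mem_schrCPFun ψ.2).coeFn_toLp

theorem schrState_eq {u : T.HS} {ψ : T.schrCPFun} (hu : u =ᵐ[T.nuQ] (ψ : Hat T.Q → ℂ)) :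
    T.schrState ψ = u :=
  Lp.ext ((T.schrState_ae_eq ψ).trans hu.symm)

/-- The action of an observable on the reduced wave functions in `schrCPFun`. -/
def schrQuantCP (F : StrongDual ℝ L) (ψ : T.schrCPFun) : T.schrCPFun :=
  ⟨T.schrQuant F ψ, T.schrQuant_mem_schrCPFun F ψ.2⟩

/-! ### The flow of an observable on reduced wave functions -/

theorem schrRe_sub_smul (σ X : L) (t : ℝ) :
    T.schrRe (σ - t • X) = T.schrRe σ - t • T.schrRe X := by
  simp only [schrRe, map_sub, map_smul, ContinuousLinearMap.sub_comp,
    ContinuousLinearMap.smul_comp]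

theorem schrIm_sub_smul (σ X : L) (t : ℝ) :
    T.schrIm (σ - t • X) = T.schrIm σ - t • T.schrIm X := by
  ext φ
  obtain ⟨ξ, rfl⟩ := T.M.mkQ_surjective φ
  simp only [schrIm, sub_apply, FunLike.coe_smul, Pi.smul_apply, bracketQ_q, map_sub, map_smul]

theorem ext_schrExponent_incl_q (σ X : L) :
    ext (T.schrExponent σ) (incl (T.q X)) = (⟪T.fieldPart σ, T.fieldPart X⟫_ℝ : ℂ)
      + ⟪T.J (T.momentumPart σ), T.fieldPart X⟫_ℝ * Complex.I := by
  rw [ext_schrExponent, T.inner_fieldPart (T.fieldPart_mem σ),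
    T.inner_fieldPart ⟨_, T.momentumPart_mem σ, rfl⟩, ← schrRe_apply_q, ← schrIm_apply_q]
  rfl

theorem schrConst_sub_smul (σ X : L) (t : ℝ) :
    T.schrConst (σ - t • X) = T.schrConst σ + t * (⟪T.fieldPart σ, T.fieldPart X⟫_ℝ
      + Complex.I / 2 * (⟪T.J (T.momentumPart σ), T.fieldPart X⟫_ℝ
        + ⟪T.J (T.momentumPart X), T.fieldPart σ⟫_ℝ)) + t ^ 2 * T.schrConst X := by
  simp only [schrConst_eq, ← real_inner_self_eq_norm_sq, map_sub, map_smul, inner_sub_left,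
    inner_sub_right, real_inner_smul_left, real_inner_smul_right,
    real_inner_comm (T.fieldPart X) (T.fieldPart σ)]
  push_cast
  ring

theorem omega_eq_inner_J_momentumPart_sub (σ X : L) :
    T.omega σ X = 1 / 2 * (⟪T.J (T.momentumPart σ), T.fieldPart X⟫_ℝ
      - ⟪T.J (T.momentumPart X), T.fieldPart σ⟫_ℝ) := by
  rw [← inner_J_eq_inner_J_momentumPart_sub, inner_J_left]
  ring

/-- The translate of a reduced wave function by `-t q(X)`, multiplied by `exp (t E_X)` with `E_X`
the exponent of the coherent state of `X`.  For `X = X_F` the derivative in `t = 0` is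
`-i F̌ ψ`. -/
def schrFlow (X : L) (ψ : Hat T.Q → ℂ) (t : ℝ) (φ : Hat T.Q) : ℂ :=
  Complex.exp (t * ext (T.schrExponent X) φ) * ψ (φ + t • -incl (T.q X))

theorem hasDerivAt_integral_conj_schrCoherent_mul_schrFlow (σ : L) (F : StrongDual ℝ L)
    {ψ : Hat T.Q → ℂ} (hψ : IsExpPoly ψ) :
    HasDerivAt
      (fun t => ∫ φ, (starRingEnd ℂ) (T.schrCoherent σ φ) * T.schrFlow (T.ham F) ψ t φ ∂T.nuQ)
      (-Complex.I * ∫ φ, (starRingEnd ℂ) (T.schrCoherent σ φ) * T.schrQuant F ψ φ ∂T.nuQ) 0 := by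
  refine (hψ.hasDerivAt_integral_mul_translate (T.isExpPoly_schrCoherent σ).isExpBounded.conj
    (Complex.continuous_conj.measurable.comp (T.isExpPoly_schrCoherent σ).measurable)
    T.isHatGaussian_nuQ (T.schrExponent (T.ham F)) (-incl (T.q (T.ham F)))).congr_deriv ?_
  rw [← integral_const_mul]
  congr with φ
  rw [schrQuant_apply, mul_left_comm, ← mul_assoc (-Complex.I), neg_mul, Complex.I_mul_I, neg_neg,
    one_mul]

theorem cameronMartin_mul_conj_schrCoherent (σ X : L) (t : ℝ) (φ : Hat T.Q) :
    Complex.exp (φ (-(2 * t) • T.schrRe X) - (1 / 2 : ℝ≥0) / 2 * ‖-(2 * t) • T.schrRe X‖ ^ 2)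
        * ((starRingEnd ℂ) (T.schrCoherent σ (φ + t • incl (T.q X)))
          * Complex.exp (t * ext (T.schrExponent X) (φ + t • incl (T.q X))))
      = Complex.exp (-(Complex.I * T.omega σ X * t) - t ^ 2 * T.schrConst X)
        * (starRingEnd ℂ) (T.schrCoherent (σ - t • X) φ) := by
  have hnorm : (‖-(2 * t) • T.schrRe X‖ : ℂ) ^ 2 = (2 * t) ^ 2 * ‖T.fieldPart X‖ ^ 2 := by
    rw [← T.dualEmbedding.norm_map, map_smul, dualEmbedding_schrRe, norm_smul,
      Complex.ofReal_mul, mul_pow, norm_neg, Real.norm_eq_abs, ← Complex.ofReal_pow |_|, sq_abs]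
    push_cast
    ring
  rw [schrCoherent_apply, schrCoherent_apply, ← Complex.exp_conj, ← Complex.exp_conj,
    ← Complex.exp_add, ← Complex.exp_add, ← Complex.exp_add, hnorm, schrConst_sub_smul,
    omega_eq_inner_J_momentumPart_sub, T.schrConst_eq X]
  simp only [ext_add_right, ext_smul_right, ext_schrExponent_incl_q]
  simp only [ext_schrExponent, schrRe_sub_smul, schrIm_sub_smul]
  simp only [map_add, map_sub, map_mul, map_smul, smul_eq_mul, Complex.conj_ofReal, Complex.conj_I,
    map_div₀, Complex.conj_ofNat, map_pow, real_inner_self_eq_norm_sq]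
  push_cast
  congr 1
  ring

theorem integral_conj_schrCoherent_mul_schrFlow (σ X : L) (t : ℝ) {ψ : Hat T.Q → ℂ}
    (hψ : Measurable ψ) :
    ∫ φ, (starRingEnd ℂ) (T.schrCoherent σ φ) * T.schrFlow X ψ t φ ∂T.nuQ
      = Complex.exp (-(Complex.I * T.omega σ X * t) - t ^ 2 * T.schrConst X)
        * ∫ φ, (starRingEnd ℂ) (T.schrCoherent (σ - t • X) φ) * ψ φ ∂T.nuQ := by
  let y : Hat T.Q := t • incl (T.q X)
  let G (φ : Hat T.Q) : ℂ := (starRingEnd ℂ) (T.schrCoherent σ (φ + y))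
    * Complex.exp (t * ext (T.schrExponent X) (φ + y)) * ψ φ
  have hG : Measurable G := ((Complex.continuous_conj.measurable.comp
    ((T.isExpPoly_schrCoherent σ).measurable.comp (measurable_add_right_hat y))).mul
      (Complex.measurable_exp.comp
        (((measurable_ext _).comp (measurable_add_right_hat y)).const_mul _))).mul hψ
  have hy (b : StrongDual ℝ T.Q) : (-y) b = (1 / 2 : ℝ≥0)
      * ⟪T.dualEmbedding (-(2 * t) • T.schrRe X), T.dualEmbedding b⟫_ℝ := by
    have hyb : (-y) b = -(t * b (T.q X)) := rfl
    rw [hyb, map_smul, dualEmbedding_schrRe, real_inner_smul_left, real_inner_comm,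
      T.inner_fieldPart (T.dualEmbedding_mem_JM b), inner_dualEmbedding]
    push_cast
    ring
  calc ∫ φ, (starRingEnd ℂ) (T.schrCoherent σ φ) * T.schrFlow X ψ t φ ∂T.nuQ
      = ∫ φ, G (φ + -y) ∂T.nuQ := by
        simp only [G, y, schrFlow, neg_add_cancel_right, smul_neg, mul_assoc]
    _ = _ := by
        rw [T.isHatGaussian_nuQ.integral_add T.dualEmbedding _ (-y) hy hG, ← integral_const_mul]
        congr with φ
        rw [← mul_assoc, T.cameronMartin_mul_conj_schrCoherent, mul_assoc]

/-! ### Observables in the holomorphic representation -/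

theorem hasLineDerivAt_wave_cmul (u : T.HH) (σ X : L) (c : ℂ) :
    HasLineDerivAt ℝ (T.wave u) (c * deriv (fun z : ℂ => T.wave u (σ + T.cmul z X)) 0) σ
      (T.cmul c X) := by
  have hline : HasDerivAt (fun t : ℝ => (t : ℂ) * c) c 0 := by
    simpa using (hasDerivAt_id (0 : ℝ)).ofReal_comp.mul_const c
  have hcomp := HasDerivAt.comp_of_eq (h := fun t : ℝ => (t : ℂ) * c) (0 : ℝ)
    (T.differentiable_wave u σ X 0).hasDerivAt hline (by simp)
  have hcmul (t : ℝ) : T.cmul (t * c) X = t • T.cmul c X := by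
    rw [cmul_mul, ContinuousLinearMap.comp_apply, cmul_apply, Complex.ofReal_re, Complex.ofReal_im,
      zero_smul, add_zero]
  rw [mul_comm]
  simpa only [HasLineDerivAt, Function.comp_def, hcmul] using hcomp

theorem lineDeriv_wave_cmul (u : T.HH) (σ X : L) (c : ℂ) :
    lineDeriv ℝ (T.wave u) σ (T.cmul c X) = c * lineDeriv ℝ (T.wave u) σ X := by
  have hone := (T.hasLineDerivAt_wave_cmul u σ X 1).lineDeriv
  rw [cmul_one, one_mul] at hone
  rw [(T.hasLineDerivAt_wave_cmul u σ X c).lineDeriv, ← hone]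
  rfl

theorem lineDeriv_wave_J (u : T.HH) (σ X : L) :
    lineDeriv ℝ (T.wave u) σ (T.J X) = Complex.I * lineDeriv ℝ (T.wave u) σ X := by
  simpa [cmul_apply] using T.lineDeriv_wave_cmul u σ X Complex.I

theorem hasLineDerivAt_wave (u : T.HH) (σ X : L) :
    HasLineDerivAt ℝ (T.wave u) (lineDeriv ℝ (T.wave u) σ X) σ X := by
  have hone := (T.hasLineDerivAt_wave_cmul u σ X 1).lineDifferentiableAt.hasLineDerivAt
  rwa [cmul_one] at hone

theorem hasDerivAt_wave_sub_smul (u : T.HH) (σ X : L) :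
    HasDerivAt (fun t : ℝ => T.wave u (σ - t • X)) (-lineDeriv ℝ (T.wave u) σ X) 0 := by
  have hneg := T.hasLineDerivAt_wave_cmul u σ X (-1)
  rw [← hneg.lineDeriv, T.lineDeriv_wave_cmul] at hneg
  simpa [HasLineDerivAt, cmul_apply, sub_eq_add_neg] using hneg

theorem holPart_eq (F : StrongDual ℝ L) (σ : L) : T.holPart F σ
    = T.omega σ (T.ham F) + Complex.I / 2 * ⟪σ, T.ham F⟫_ℝ := by
  rw [holPart, ← T.two_mul_omega_ham F σ, ← T.two_mul_omega_ham F (T.J σ),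
    ← T.inner_J_left (T.J σ), T.J_sq, inner_neg_left]
  push_cast
  ring

theorem holQuant_wave (F : StrongDual ℝ L) (u : T.HH) (σ : L) :
    T.holQuant F (T.wave u) σ
      = (T.omega σ (T.ham F) + Complex.I / 2 * ⟪σ, T.ham F⟫_ℝ) * T.wave u σ
        - Complex.I * lineDeriv ℝ (T.wave u) σ (T.ham F) := by
  rw [holQuant, holPart_eq, lineDeriv_wave_J]
  linear_combination
    Complex.I / 2 * lineDeriv ℝ (T.wave u) σ (T.ham F) * Complex.I_sq

theorem holQuant_wave_add (F : StrongDual ℝ L) (u v : T.HH) :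
    T.holQuant F (T.wave u + T.wave v) = T.holQuant F (T.wave u) + T.holQuant F (T.wave v) := by
  funext σ
  have hadd : lineDeriv ℝ (T.wave u + T.wave v) σ (T.ham F)
      = lineDeriv ℝ (T.wave u) σ (T.ham F) + lineDeriv ℝ (T.wave v) σ (T.ham F) :=
    (HasDerivAt.add (T.hasLineDerivAt_wave u σ _) (T.hasLineDerivAt_wave v σ _)).deriv
  rw [← map_add, Pi.add_apply, holQuant_wave, holQuant_wave, holQuant_wave, map_add, hadd,
    Pi.add_apply]
  ring

theorem holQuant_smul (F : StrongDual ℝ L) (c : ℂ) (ψ : L → ℂ) :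
    T.holQuant F (c • ψ) = c • T.holQuant F ψ := by
  funext ξ
  have hsmul (X : L) : lineDeriv ℝ (c • ψ) ξ X = c * lineDeriv ℝ ψ ξ X := deriv_const_mul_field c
  simp only [holQuant, Pi.smul_apply, hsmul, smul_eq_mul]
  ring

/-! ### Intertwining -/

theorem hasDerivAt_exp_mul_wave_sub_smul (u : T.HH) (F : StrongDual ℝ L) (σ : L) (c : ℂ) :
    HasDerivAt (fun t : ℝ => Complex.exp (-(Complex.I * T.omega σ (T.ham F) * t) - t ^ 2 * c)
        * (Complex.exp (-(1 / 4) * (‖σ - t • T.ham F‖ ^ 2 : ℝ)) * T.wave u (σ - t • T.ham F)))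
      (-Complex.I * (Complex.exp (-(1 / 4) * (‖σ‖ ^ 2 : ℝ)) * T.holQuant F (T.wave u) σ)) 0 := by
  have hid : HasDerivAt (fun t : ℝ => (t : ℂ)) 1 0 := (hasDerivAt_id (0 : ℝ)).ofReal_comp
  have hphase : HasDerivAt
      (fun t : ℝ => Complex.exp (-(Complex.I * T.omega σ (T.ham F) * t) - t ^ 2 * c))
      (-(Complex.I * T.omega σ (T.ham F))) 0 := by
    simpa using (((hid.const_mul (Complex.I * T.omega σ (T.ham F))).neg).sub
      ((hid.pow 2).mul_const c)).cexp
  refine (hphase.mul ((hasDerivAt_exp_neg_norm_sq_sub_smul σ (T.ham F)).mul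
    (T.hasDerivAt_wave_sub_smul u σ (T.ham F)))).congr_deriv ?_
  simp only [Pi.mul_apply, holQuant_wave, zero_smul, sub_zero, Complex.ofReal_zero, mul_zero,
    neg_zero, zero_pow two_ne_zero, zero_mul, Complex.exp_zero, one_mul]
  linear_combination Complex.exp (-(1 / 4) * (‖σ‖ ^ 2 : ℝ))
    * (1 / 2 * ⟪σ, T.ham F⟫_ℝ * T.wave u σ - lineDeriv ℝ (T.wave u) σ (T.ham F))
    * Complex.I_sq

/-- The holomorphic wave function on `L` of the Segal–Bargmann transform of the state represented
by a reduced wave function in `schrCPFun`. -/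
def waveTransform : T.schrCPFun →ₗ[ℂ] (L → ℂ) :=
  T.wave ∘ₗ T.segalBargmann.toLinearEquiv.toLinearMap ∘ₗ T.schrState

theorem waveTransform_apply (ψ : T.schrCPFun) :
    T.waveTransform ψ = T.wave (T.segalBargmann (T.schrState ψ)) := rfl

theorem waveTransform_schrQuantCP (F : StrongDual ℝ L) (ψ : T.schrCPFun) :
    T.waveTransform (T.schrQuantCP F ψ) = T.holQuant F (T.waveTransform ψ) := by
  funext σ
  have hψ := T.isExpPoly_of_mem_schrCPFun ψ.2
  have hschr := T.hasDerivAt_integral_conj_schrCoherent_mul_schrFlow σ F hψ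
  have hquant : ∫ φ, (starRingEnd ℂ) (T.schrCoherent σ φ) * T.schrQuant F ψ φ ∂T.nuQ
      = ⟪T.schrCoherentState σ, T.schrState (T.schrQuantCP F ψ)⟫_ℂ :=
    (T.inner_schrCoherentState σ (T.schrState_ae_eq (T.schrQuantCP F ψ))).symm
  simp only [T.integral_conj_schrCoherent_mul_schrFlow _ _ _ hψ.measurable, hquant,
    ← T.inner_schrCoherentState _ (T.schrState_ae_eq ψ), inner_schrCoherentState_eq_wave] at hschr
  have heq := hschr.unique (T.hasDerivAt_exp_mul_wave_sub_smul _ F σ _)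
  exact mul_left_cancel₀ (Complex.exp_ne_zero _)
    (mul_left_cancel₀ (neg_ne_zero.2 Complex.I_ne_zero) heq)

/-! ### The spaces generated from the coherent states by observables -/

theorem waveTransform_foldr (s : List (StrongDual ℝ L)) (τ : L) :
    T.waveTransform ⟨_, T.foldr_schrQuant_mem_schrCPFun s τ⟩
      = Complex.exp (-(1 / 4) * (⟪τ, τ⟫_ℝ : ℂ)) • s.foldr T.holQuant (T.holCoherent τ) := by
  induction s with
  | nil =>
    have hstate : T.schrState ⟨_, T.foldr_schrQuant_mem_schrCPFun [] τ⟩ = T.schrCoherentState τ :=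
      T.schrState_eq (T.schrCoherentState_ae_eq τ)
    rw [waveTransform_apply, hstate, segalBargmann_schrCoherentState, holNormalizedState, map_smul,
      wave_holCoherentState]
    rfl
  | cons F s ih =>
    refine (T.waveTransform_schrQuantCP F ⟨_, T.foldr_schrQuant_mem_schrCPFun s τ⟩).trans ?_
    rw [ih, holQuant_smul]
    rfl

theorem range_waveTransform : LinearMap.range T.waveTransform = T.holCPFun := by
  have hexp (τ : L) : Complex.exp (-(1 / 4) * (⟪τ, τ⟫_ℝ : ℂ)) ≠ 0 := Complex.exp_ne_zero _
  refine le_antisymm ?_ (Submodule.span_le.2 ?_)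
  · rintro _ ⟨⟨ψ, hψ⟩, rfl⟩
    induction hψ using Submodule.span_induction with
    | mem ψ hψ =>
      obtain ⟨⟨s, τ⟩, rfl⟩ := hψ
      rw [waveTransform_foldr]
      exact Submodule.smul_mem _ _ (Submodule.subset_span ⟨(s, τ), rfl⟩)
    | zero => exact (map_zero T.waveTransform).symm ▸ zero_mem _
    | add ψ χ hψ hχ ihψ ihχ =>
      exact (map_add T.waveTransform ⟨ψ, hψ⟩ ⟨χ, hχ⟩).symm ▸ add_mem ihψ ihχ
    | smul c ψ hψ ih =>
      exact (map_smul T.waveTransform c ⟨ψ, hψ⟩).symm ▸ Submodule.smul_mem _ c ih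
  · rintro _ ⟨⟨s, τ⟩, rfl⟩
    refine ⟨(Complex.exp (-(1 / 4) * (⟪τ, τ⟫_ℝ : ℂ)))⁻¹ •
      ⟨_, T.foldr_schrQuant_mem_schrCPFun s τ⟩, ?_⟩
    rw [map_smul, waveTransform_foldr, inv_smul_smul₀ (hexp τ)]

theorem exists_wave_eq {χ : L → ℂ} (hχ : χ ∈ T.holCPFun) : ∃ u, T.wave u = χ := by
  rw [← range_waveTransform] at hχ
  obtain ⟨ψ, rfl⟩ := hχ
  exact ⟨_, rfl⟩

theorem holQuant_mem_holCPFun (F : StrongDual ℝ L) {χ : L → ℂ} (hχ : χ ∈ T.holCPFun) :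
    T.holQuant F χ ∈ T.holCPFun := by
  rw [← range_waveTransform] at hχ ⊢
  obtain ⟨ψ, rfl⟩ := hχ
  exact ⟨T.schrQuantCP F ψ, T.waveTransform_schrQuantCP F ψ⟩

theorem map_HScp :
    T.HScp.map (T.segalBargmann.toLinearEquiv : T.HS →ₗ[ℂ] T.HH) = T.HHcp := by
  ext u
  rw [HHcp, Submodule.mem_comap, ← range_waveTransform]
  constructor
  · rintro ⟨v, ⟨ψ, hψ, hv⟩, rfl⟩
    exact ⟨⟨ψ, hψ⟩, congrArg (T.wave ∘ T.segalBargmann) (T.schrState_eq hv)⟩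
  · rintro ⟨ψ, hψ⟩
    exact ⟨T.schrState ψ, ⟨ψ, ψ.2, T.schrState_ae_eq ψ⟩, T.wave_injective hψ⟩

/-- The restriction of the Segal–Bargmann transform to the states generated from the coherent
states by observables. -/
def segalBargmannCP : T.HScp ≃ₗ[ℂ] T.HHcp :=
  T.segalBargmann.toLinearEquiv.ofSubmodules T.HScp T.HHcp T.map_HScp

theorem coe_segalBargmannCP (u : T.HScp) : (T.segalBargmannCP u : T.HH) = T.segalBargmann u := rfl

/-- The states in `HHcp` correspond to their wave functions. -/
def waveCP : T.HHcp ≃ₗ[ℂ] T.holCPFun :=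
  LinearEquiv.ofBijective (T.wave.submoduleComap T.holCPFun)
    ⟨fun _ _ h => Subtype.ext (T.wave_injective (congrArg Subtype.val h)), fun ⟨χ, hχ⟩ => by
      obtain ⟨u, rfl⟩ := T.exists_wave_eq hχ
      exact ⟨⟨u, hχ⟩, rfl⟩⟩

/-- The operator on the holomorphic wave functions in `holCPFun` quantizing an observable. -/
def holQuantCP (F : StrongDual ℝ L) : Module.End ℂ T.holCPFun where
  toFun χ := ⟨T.holQuant F χ, T.holQuant_mem_holCPFun F χ.2⟩
  map_add' χ χ' := by
    obtain ⟨u, rfl⟩ := T.waveCP.surjective χ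
    obtain ⟨v, rfl⟩ := T.waveCP.surjective χ'
    exact Subtype.ext (T.holQuant_wave_add F u v)
  map_smul' c χ := Subtype.ext (T.holQuant_smul F c χ)

/-- The operator on `HHcp` quantizing an observable. -/
def holOperator (F : StrongDual ℝ L) : Module.End ℂ T.HHcp := T.waveCP.symm.conj (T.holQuantCP F)

theorem wave_holOperator (F : StrongDual ℝ L) (u : T.HHcp) :
    T.wave (T.holOperator F u) = T.holQuant F (T.wave u) :=
  congrArg Subtype.val (T.waveCP.apply_symm_apply (T.holQuantCP F (T.waveCP u)))

/-- The operator on `HScp` quantizing an observable.  It is transported from `HHcp`, where a state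
determines its wave function everywhere and not only almost everywhere. -/
def schrOperator (F : StrongDual ℝ L) : Module.End ℂ T.HScp :=
  T.segalBargmannCP.symm.conj (T.holOperator F)

theorem segalBargmannCP_schrOperator (F : StrongDual ℝ L) (u : T.HScp) :
    T.segalBargmannCP (T.schrOperator F u) = T.holOperator F (T.segalBargmannCP u) :=
  T.segalBargmannCP.apply_symm_apply _

theorem schrOperator_ae_eq (F : StrongDual ℝ L) {u : T.HScp} {ψ : Hat T.Q → ℂ}
    (hψ : ψ ∈ T.schrCPFun) (hu : (u : T.HS) =ᵐ[T.nuQ] ψ) :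
    (T.schrOperator F u : T.HS) =ᵐ[T.nuQ] T.schrQuant F ψ := by
  have hstate : (T.schrOperator F u : T.HS) = T.schrState (T.schrQuantCP F ⟨ψ, hψ⟩) := by
    refine T.segalBargmann.injective (T.wave_injective ?_)
    rw [← coe_segalBargmannCP, segalBargmannCP_schrOperator, wave_holOperator, coe_segalBargmannCP,
      ← waveTransform_apply, waveTransform_schrQuantCP, waveTransform_apply, T.schrState_eq hu]
  rw [hstate]
  exact T.schrState_ae_eq _

end FieldTheory

end
end OecklQuantization

theorem mainTheorem7_general {L : Type*} [NormedAddCommGroup L] [InnerProductSpace ℝ L]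
    [CompleteSpace L] (T : OecklQuantization.FieldTheory L) :
    ∃ B : T.HS ≃ₗᵢ[ℂ] T.HH,
      (∀ τ, B (T.schrCoherentState τ) = T.holNormalizedState τ) ∧
      (∀ B' : T.HS ≃ₗᵢ[ℂ] T.HH,
        (∀ τ, B' (T.schrCoherentState τ) = T.holNormalizedState τ) → B' = B) ∧
      (∀ ψ ∈ T.schrCPFun, MemLp ψ 2 T.nuQ) ∧
      (∀ ψ ∈ T.holCPFun, ∃ u, T.wave u = ψ) ∧
      ∃ (ρS : StrongDual ℝ L → Module.End ℂ T.HScp) (ρH : StrongDual ℝ L → Module.End ℂ T.HHcp)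
        (Bcp : T.HScp ≃ₗ[ℂ] T.HHcp),
        (∀ F (u : T.HScp), ∀ ψ ∈ T.schrCPFun, (u : T.HS) =ᵐ[T.nuQ] ψ →
          (ρS F u : T.HS) =ᵐ[T.nuQ] T.schrQuant F ψ) ∧
        (∀ F (u : T.HHcp), T.wave (ρH F u) = T.holQuant F (T.wave u)) ∧
        (∀ u : T.HScp, (Bcp u : T.HH) = B u) ∧
        ∀ F (u : T.HScp), Bcp (ρS F u) = ρH F (Bcp u) :=
  ⟨T.segalBargmann, T.segalBargmann_schrCoherentState, fun _ => T.eq_segalBargmann,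
    fun _ => T.memLp_of_mem_schrCPFun, fun _ => T.exists_wave_eq,
    T.schrOperator, T.holOperator, T.segalBargmannCP,
    fun F _ _ => T.schrOperator_ae_eq F, T.wave_holOperator, T.coe_segalBargmannCP,
    T.segalBargmannCP_schrOperator⟩

theorem mainTheorem7 {L : Type*} [NormedAddCommGroup L] [InnerProductSpace ℝ L] [CompleteSpace L]
    [TopologicalSpace.SeparableSpace L] (T : OecklQuantization.FieldTheory L) :
    ∃ B : T.HS ≃ₗᵢ[ℂ] T.HH,
      -- `B` is the unique isometric isomorphism that matches the normalized coherent states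
      (∀ τ, B (T.schrCoherentState τ) = T.holNormalizedState τ) ∧
      (∀ B' : T.HS ≃ₗᵢ[ℂ] T.HH,
        (∀ τ, B' (T.schrCoherentState τ) = T.holNormalizedState τ) → B' = B) ∧
      -- all generated functions represent states
      (∀ ψ ∈ T.schrCPFun, MemLp ψ 2 T.nuQ) ∧
      (∀ ψ ∈ T.holCPFun, ∃ u, T.wave u = ψ) ∧
      -- the quantized observables are well defined operators on the two spaces, and `B`
      -- restricts to an isomorphism that intertwines them
      ∃ (ρS : StrongDual ℝ L → Module.End ℂ T.HScp) (ρH : StrongDual ℝ L → Module.End ℂ T.HHcp)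
        (Bcp : T.HScp ≃ₗ[ℂ] T.HHcp),
        (∀ F (u : T.HScp), ∀ ψ ∈ T.schrCPFun, (u : T.HS) =ᵐ[T.nuQ] ψ →
          (ρS F u : T.HS) =ᵐ[T.nuQ] T.schrQuant F ψ) ∧
        (∀ F (u : T.HHcp), T.wave (ρH F u) = T.holQuant F (T.wave u)) ∧
        (∀ u : T.HScp, (Bcp u : T.HH) = B u) ∧
        ∀ F (u : T.HScp), Bcp (ρS F u) = ρH F (Bcp u) :=
  mainTheorem7_general T
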